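/- Let $f,g\in\mathbb Z[x,y]$ be such that $\{f,g\}$ is zero-dimensional, i.e. $f=g=0$ has only finitely many solutions in $\mathbb C^2$. For a number $s$ write $f_s=f(x+sy,y)$, $g_s=g(x+sy,y)$ and $R_2=\operatorname{res}_y(f_s,g_s)$. *Definitions.* A system $\{F,G\}$ in $x,y$ is in **generic position** w.r.t. $y$ if the leading coefficients of $F$ and $G$ w.r.t. $y$ (polynomials in $x$ over $\mathbb Q$ or $\mathbb R$) have no common factor and, for every $\alpha\in\mathbb C$ with $\operatorname{res}_y(F,G)(\alpha)=0$, the polynomials $F(\alpha,y),G(\alpha,y)$ have exactly one common zero in $\mathbb C$; it is in **real generic position** if the last condition is only required for $\alpha\in\mathbb R$. The **multiplicity** of a zero $p$ of $\{f,g\}$ is $\dim_{\mathbb C}\mathbb C[x,y]_p/(f,g)$. *Real root candidates.* Intervals are closed with rational endpoints. For an interval $J$ and $f=\sum_i h_i(x)y^i$ let $[a_i,b_i]=h_i(J)$ be computed by interval arithmetic in Horner form; the bounding polynomials are $f^d_J=\sum_i a_iy^i$ and $f^u_J=\sum_i b_iy^i$. The root region of $f$ over $J$ is the set of $y\ge 0$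 with $f^d_J(y)f^u_J(y)\le 0$ together with the set of $y\le 0$ obtained in the same way from $f(x,-y)$ at $-y$. Choose pairwise disjoint isolating intervals $J$ for all the real roots of $\operatorname{res}_y(f,g)$ and, for each $J$, with isolated root $\alpha$, an interval $B$ that contains the $y$-coordinates of all the real solutions of $f=g=0$ with $x\in J$. Effective real roots of $f(J,y)$ are a finite family of intervals covering the part in $B$ of the root region of $f$ over $J$, where top coefficients $h_i$ with $h_i(\alpha)=0$ may be dropped from $f$ beforehand; similarly for $g$. The real root candidates are all boxes $J\times K$ with $K$ a nonempty intersection of an effective real root of $f(J,y)$ with one of $g(J,y)$. Let $\mathcal B$ be any list of real root candidates so obtained, let $S\subset\mathbb R$ be the set of all $s$ such that $(J-sK)\cap(J'-sK')\ne\emptyset$ for two different boxes $J\times K,\ J'\times K'$ of $\mathcal B$, and call $s\in\mathbb Q$ admissible if $0\ne s\notin S$. Let $\mathcal L(s)$ be the maximal bitsize of the numerator and the denominator of $s$. Then: 1. A random shear puts the system in generic position with probability 1: the set of $s\in\mathbb R$ for which $\{f_s,g_s\}$ is not in generic position is finite; hence, for every probability measure on $\mathbb R$ without atoms, $\{f_s,g_s\}$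 is in generic position for almost every $s$; and, if an admissible $s$ exists, the proportion of those $s$ for which $\{f_s,g_s\}$ is in generic position among the admissible $s$ with $\mathcal L(s)\le N$ tends to $1$ as $N\to\infty$. 2. For every admissible $s$ (in particular for one with $\mathcal L(s)$ minimal) such that $\{f_s,g_s\}$ is in generic position, or only in real generic position, and for every box $J\times K$ of $\mathcal B$, the map $(x,y)\mapsto x-sy$ is a bijection from the set of real solutions of $f=g=0$ in $J\times K$ onto the set of real roots of $R_2$ in $J-sK$, and the multiplicity of each such solution $(x,y)$ of $\{f,g\}$ equals the multiplicity of $x-sy$ as a root of $R_2$. -/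

import Mathlib

open Polynomial MeasureTheory Filter Topology
open scoped Polynomial.Bivariate

noncomputable section

namespace BivariateShear

/-! Bivariate polynomials are elements of `R[X][Y]`: the outer variable is `y`, the inner one `x`,
and `aevalAeval a b f` is the value `f(a, b)`. -/

/-! ### Systems, resultants, generic position -/

section Systems

variable {K : Type*} [CommRing K] [Algebra K ℂ]

/-- `(a, b)` is a complex zero of the system `{f, g}`. -/
def IsZero (f g : K[X][Y]) (p : ℂ × ℂ) : Prop :=
  aevalAeval p.1 p.2 f = 0 ∧ aevalAeval p.1 p.2 g = 0

/-- The system `{f, g}` is zero-dimensional: it has finitely many complex zeros. -/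
def IsZeroDimensional (f g : K[X][Y]) : Prop :=
  {p : ℂ × ℂ | IsZero f g p}.Finite

/-- `res_y(f, g)`. -/
def resY (f g : K[X][Y]) : K[X] := resultant f g

/-- `{f, g}` is in a generic position with respect to `y`: the leading coefficients with respect
to `y` have no common factor, and above every complex root `α` of `res_y(f, g)` there is exactly
one common complex zero of `f(α, y)` and `g(α, y)`. -/
def InGenericPosition (f g : K[X][Y]) : Prop :=
  IsCoprime f.leadingCoeff g.leadingCoeff ∧
    ∀ α : ℂ, aeval α (resY f g) = 0 → ∃! β : ℂ, IsZero f g (α, β)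

/-- The variant of generic position in which the fibre condition is only required at the real
roots `α` of `res_y(f, g)`; the common zero is still unique among all complex numbers. -/
def InRealGenericPosition (f g : K[X][Y]) : Prop :=
  IsCoprime f.leadingCoeff g.leadingCoeff ∧
    ∀ α : ℝ, aeval (α : ℂ) (resY f g) = 0 → ∃! β : ℂ, IsZero f g ((α : ℂ), β)

theorem InGenericPosition.real {f g : K[X][Y]} (h : InGenericPosition f g) :
    InRealGenericPosition f g :=
  ⟨h.1, fun α hα => h.2 α hα⟩

end Systems

/-- The sheared polynomial `f(x + s y, y)`. -/
def shear {K : Type*} [CommRing K] (s : K) (f : ℤ[X][Y]) : K[X][Y] :=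
  aevalAeval (C X + C (C s) * Y : K[X][Y]) (Y : K[X][Y]) f

/-- `(x, y)` is a real zero of the system `{f, g}`. -/
def IsRealZero (f g : ℤ[X][Y]) (p : ℝ × ℝ) : Prop :=
  aevalAeval p.1 p.2 f = 0 ∧ aevalAeval p.1 p.2 g = 0

/-! ### Multiplicity of a zero of a system -/

/-- For a prime ideal `P` and an ideal `I` of a `k`-algebra `A`, the dimension over `k` of the
quotient `A_P / I A_P` of the local ring of `A` at `P`. -/
def localMultiplicity (k : Type*) {A : Type*} [Field k] [CommRing A] [Algebra k A]
    (P : Ideal A) [P.IsPrime] (I : Ideal A) : ℕ :=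
  Module.finrank k
    (Localization.AtPrime P ⧸ I.map (algebraMap A (Localization.AtPrime P)))

/-- The maximal ideal of the point `p` in `ℂ[x, y]`. -/
def pointIdeal (p : ℂ × ℂ) : Ideal ℂ[X][Y] := RingHom.ker (evalEvalRingHom p.1 p.2)

instance (p : ℂ × ℂ) : (pointIdeal p).IsPrime := RingHom.ker_isPrime _

/-- `f` with integer coefficients, regarded as a complex polynomial. -/
def toComplex (f : ℤ[X][Y]) : ℂ[X][Y] := f.map (mapRingHom (Int.castRingHom ℂ))

/-- The multiplicity of `p` as a zero of `{f, g}`: the dimension over `ℂ` of `ℂ[x, y]_p / (f, g)`,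
where `ℂ[x, y]_p` is the local ring of the plane at `p`. -/
def multiplicity (f g : ℤ[X][Y]) (p : ℂ × ℂ) : ℕ :=
  localMultiplicity ℂ (pointIdeal p) (Ideal.span {toComplex f, toComplex g})

/-! ### Interval arithmetic and interval polynomials -/

/-- Closed bounded intervals with rational endpoints. -/
abbrev RInt := NonemptyInterval ℚ

/-- The set of real numbers in the interval `I`. -/
def realSet (I : RInt) : Set ℝ := Set.Icc (I.fst : ℝ) (I.snd : ℝ)

/-- Product of two intervals. -/
def imul (A B : RInt) : RInt where
  fst := min (min (A.fst * B.fst) (A.fst * B.snd)) (min (A.snd * B.fst) (A.snd * B.snd))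
  snd := max (max (A.fst * B.fst) (A.fst * B.snd)) (max (A.snd * B.fst) (A.snd * B.snd))
  fst_le_snd := (min_le_left _ _).trans
    ((min_le_left _ _).trans ((le_max_left _ _).trans (le_max_left _ _)))

/-- Interval evaluation `h(I)` of `h = a₀ + a₁ x + ⋯ + aₙ xⁿ` in Horner form
`a₀ + I (a₁ + I (⋯ + I aₙ))`. -/
def hornerEval (h : ℤ[X]) (I : RInt) : RInt :=
  (List.range (h.natDegree + 1)).foldr
    (fun k A => NonemptyInterval.pure (h.coeff k : ℚ) + imul I A) (NonemptyInterval.pure 0)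

/-- For `f = ∑ hᵢ(x) yⁱ`, the lower bounding polynomial `∑_{i ≤ m} aᵢ yⁱ` of the interval
polynomial `∑_{i ≤ m} hᵢ(I) yⁱ`, where `hᵢ(I) = [aᵢ, bᵢ]`. -/
def lowerPoly (f : ℤ[X][Y]) (I : RInt) (m : ℕ) : ℚ[X] :=
  ∑ i ∈ Finset.range (m + 1), C (hornerEval (f.coeff i) I).fst * X ^ i

/-- The upper bounding polynomial `∑_{i ≤ m} bᵢ yⁱ`. -/
def upperPoly (f : ℤ[X][Y]) (I : RInt) (m : ℕ) : ℚ[X] :=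
  ∑ i ∈ Finset.range (m + 1), C (hornerEval (f.coeff i) I).snd * X ^ i

/-- The points `y ≥ 0` at which the two bounding polynomials do not have the same strict sign. -/
def nonnegRootRegion (f : ℤ[X][Y]) (I : RInt) (m : ℕ) : Set ℝ :=
  {y | 0 ≤ y ∧ aeval y (lowerPoly f I m) * aeval y (upperPoly f I m) ≤ 0}

/-- The region of the real line occupied by the real roots of the interval polynomial `f(I, y)`:
on `y ≥ 0` it is read off from `f`, on `y ≤ 0` from `f(x, -y)`. -/
def rootRegion (f : ℤ[X][Y]) (I : RInt) (m : ℕ) : Set ℝ :=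
  nonnegRootRegion f I m ∪ {y | -y ∈ nonnegRootRegion (f.comp (-(Y : ℤ[X][Y]))) I m}

/-- The finite family `E` of rational intervals is a family of effective real roots of the interval
polynomial of `f` over `I`, within the bound `B`, where `α ∈ I`: it covers the root region
inside `B`. Top coefficients (those of index `> m`) may be left out of the interval polynomial
if they vanish at `α`. -/
def IsEffectiveRoots (f : ℤ[X][Y]) (I : RInt) (α : ℝ) (B : RInt) (E : Finset RInt) : Prop :=
  ∃ m : ℕ, (∀ i, m < i → aeval α (f.coeff i) = 0) ∧
    rootRegion f I m ∩ realSet B ⊆ ⋃ A ∈ E, realSet A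

/-! ### Real root candidates -/

/-- `𝓘` consists of pairwise disjoint isolating intervals for all the real roots of `R`. -/
def IsIsolatingFamily (R : ℤ[X]) (𝓘 : Finset RInt) : Prop :=
  (∀ J ∈ 𝓘, ∃! α : ℝ, α ∈ realSet J ∧ aeval α R = 0) ∧
    (∀ α : ℝ, aeval α R = 0 → ∃ J ∈ 𝓘, α ∈ realSet J) ∧
    ∀ J ∈ 𝓘, ∀ J' ∈ 𝓘, J ≠ J' → Disjoint (realSet J) (realSet J')

/-- `B` is a bound for the `y`-coordinates of the real zeros of `{f, g}` above `J`. -/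
def IsRootBound (f g : ℤ[X][Y]) (J B : RInt) : Prop :=
  ∀ p : ℝ × ℝ, p.1 ∈ realSet J → IsRealZero f g p → p.2 ∈ realSet B

/-- `𝓑` is the list of all real root candidates `J × K` of `f = g = 0` obtained from some choice
of isolating intervals `J` of the real roots of `res_y(f, g)` and, for each `J`, of effective real
roots of `f(J, y)` and of `g(J, y)`: the `K` are the nonempty intersections of an effective real
root of `f(J, y)` with one of `g(J, y)`. -/
def IsRealRootCandidates (f g : ℤ[X][Y]) (𝓑 : Finset (RInt × RInt)) : Prop :=
  ∃ (𝓘 : Finset RInt) (E F : RInt → Finset RInt),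
    IsIsolatingFamily (resY f g) 𝓘 ∧
    (∀ J ∈ 𝓘, ∃ B : RInt, IsRootBound f g J B ∧
      ∀ α ∈ realSet J, aeval α (resY f g) = 0 →
        IsEffectiveRoots f J α B (E J) ∧ IsEffectiveRoots g J α B (F J)) ∧
    ∀ J K : RInt, (J, K) ∈ 𝓑 ↔
      J ∈ 𝓘 ∧ ∃ A ∈ E J, ∃ A' ∈ F J, realSet K = realSet A ∩ realSet A'

/-! ### The choice of the shear -/

/-- The interval `J - s K`. -/
def shearedProjection (s : ℝ) (b : RInt × RInt) : Set ℝ :=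
  {t | ∃ x ∈ realSet b.1, ∃ y ∈ realSet b.2, t = x - s * y}

/-- The set `S` of the real numbers that are non-generic with respect to the list `𝓑` of boxes:
those `s` for which `J - s K` and `J' - s K'` meet for two boxes of the list. -/
def nonGenericSet (𝓑 : Finset (RInt × RInt)) : Set ℝ :=
  {s | ∃ b ∈ 𝓑, ∃ b' ∈ 𝓑, b ≠ b' ∧ (shearedProjection s b ∩ shearedProjection s b').Nonempty}

/-- The nonzero elements of `ℚ \ S`. -/
def admissibleShears (𝓑 : Finset (RInt × RInt)) : Set ℚ :=
  {s | s ≠ 0 ∧ (s : ℝ) ∉ nonGenericSet 𝓑}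

/-- The maximal bitsize of the numerator and the denominator of a rational number. -/
def bitsize (s : ℚ) : ℕ := max (Nat.size s.num.natAbs) (Nat.size s.den)

end BivariateShear

end

/-!
For a shear parameter `s`, a zero `(x, y)` of `{f, g}` becomes the zero `(x - s y, y)` of the
sheared system `{f_s, g_s}`.

*Generic shears.* The coefficient of `y ^ d` in `f(x + s y, y)`, with `d` the total degree of `f`,
is a nonzero polynomial in `s` alone, so for all but finitely many `s` the leading coefficient of
`f_s` is a nonzero constant (`finite_setOf_not_isUnit_leadingCoeff_shear`). Then the leading
coefficients are coprime and every root of `res_y(f_s, g_s)` lies below a common zero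
(`exists_isZero_of_aeval_resY`). As `{f, g}` has finitely many zeros, only finitely many `s`
identify the projections `x - s y` of two of them (`finite_setOf_collision`). The set of
admissible shears is the trace on `ℚ` of an open set, hence infinite as soon as it is nonempty,
and finitely many exceptions do not affect the limit proportion (`tendsto_proportion`).

*The bijection.* Interval arithmetic encloses the true values, so every real zero lies in some box
(`exists_mem_candidates`). If `t ∈ J - s K` is a real root of the resultant, the unique complex
zero of the sheared system above `t` is fixed by complex conjugation, hence real. The box that
contains the corresponding zero of `{f, g}` has a sheared projection through `t`, so it is `J × K`
because `s` is admissible (`bijOn_shearedProjection`).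

*Multiplicities.* Let `𝒪` be the local ring of the complex line at `t`, a principal ideal domain,
and let `F`, `G` be the sheared polynomials. One of their leading coefficients is a unit of `𝒪`,
so the cokernel of the Sylvester map over `𝒪`, whose determinant is the resultant, is
`𝒪[y] / (F, G)` (`nonempty_cokernel_sylvesterMap_equiv`). By the Smith normal form
its dimension over `ℂ` is the order of the determinant at `t` (`finrank_cokernel`).
On the other hand `x - t` is nilpotent in `𝒪[y] / (F, G)`, and `F(t, y)`, `G(t, y)` have a
single common zero, so this ring is local; hence it is the quotient of the local ring of the plane
at the zero by `(F, G)`, and the shear identifies it with the quotient that defines the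
multiplicity of the zero of `{f, g}` (`localMultiplicity_eq_rootMultiplicity`).
-/

noncomputable section

namespace BivariateShear

/-! ### Computing local multiplicities -/

/-- If `θ : A → Q` exhibits `Q` as the localization of `A / I` at the complement of `P`, then
`localMultiplicity k P I` is the dimension of `Q`. -/
theorem localMultiplicity_eq_finrank {k A Q : Type*} [Field k] [CommRing A] [Algebra k A]
    [CommRing Q] [Algebra k Q] (P : Ideal A) [P.IsPrime] (I : Ideal A) (θ : A →ₐ[k] Q)
    (hunit : ∀ a, a ∉ P → IsUnit (θ a))
    (hsurj : ∀ q, ∃ a s, s ∉ P ∧ q * θ s = θ a)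
    (hker : ∀ a, θ a = 0 ↔ ∃ s, s ∉ P ∧ s * a ∈ I) :
    localMultiplicity k P I = Module.finrank k Q := by
  have hu : ∀ s : P.primeCompl, IsUnit (θ s) := fun s => hunit s s.2
  let Θ : Localization.AtPrime P →ₐ[k] Q := IsLocalization.liftAlgHom (M := P.primeCompl) hu
  have hΘ : ∀ a, Θ (algebraMap A _ a) = θ a := fun a => IsLocalization.lift_eq hu a
  have hs : Function.Surjective Θ := by
    intro q
    obtain ⟨a, s, hsP, h⟩ := hsurj q
    refine ⟨IsLocalization.mk' _ a (⟨s, hsP⟩ : P.primeCompl), ?_⟩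
    apply (hunit s hsP).mul_left_injective
    change Θ _ * θ s = q * θ s
    rw [h, ← hΘ, ← hΘ, ← map_mul]
    congr 1
    exact IsLocalization.mk'_spec _ a (⟨s, hsP⟩ : P.primeCompl)
  have hk : I.map (algebraMap A (Localization.AtPrime P)) = RingHom.ker Θ.toRingHom := by
    ext z
    obtain ⟨a, s, rfl⟩ := IsLocalization.exists_mk'_eq P.primeCompl z
    have h1 : IsLocalization.mk' (Localization.AtPrime P) a s ∈ RingHom.ker Θ.toRingHom ↔
        θ a = 0 := by
      rw [RingHom.mem_ker]
      change Θ _ = 0 ↔ _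
      rw [← (hu s).mul_left_eq_zero, ← hΘ, ← hΘ, ← map_mul, IsLocalization.mk'_spec]
    rw [h1, hker, IsLocalization.mk'_mem_map_algebraMap_iff P.primeCompl]
    exact ⟨fun ⟨s, h1, h2⟩ => ⟨s, h1, h2⟩, fun ⟨s, h1, h2⟩ => ⟨s, h1, h2⟩⟩
  exact ((Ideal.quotientEquivAlgOfEq k hk).trans
    (Ideal.quotientKerAlgEquivOfSurjective hs)).toLinearEquiv.finrank_eq

/-! ### Cokernels over a principal ideal domain -/

/-- The Smith normal form of an injective map `φ` between free modules of the same rank: its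
cokernel is a product of cyclic modules `R / (aᵢ)`, and the determinant of `φ` is `∏ aᵢ` up to a
unit. -/
theorem exists_cokernel_equiv_pi {R M M' ι : Type*} [CommRing R] [IsDomain R]
    [IsPrincipalIdealRing R] [AddCommGroup M] [Module R M] [AddCommGroup M'] [Module R M']
    [Fintype ι] [DecidableEq ι] (b' : Module.Basis ι R M') (b : Module.Basis ι R M)
    (φ : M' →ₗ[R] M) (hφ : (LinearMap.toMatrix b' b φ).det ≠ 0) :
    ∃ a : ι → R, Associated (LinearMap.toMatrix b' b φ).det (∏ i, a i) ∧
      Nonempty ((M ⧸ LinearMap.range φ) ≃ₗ[R] Π i, R ⧸ Ideal.span {a i}) := by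
  have hinj : Function.Injective φ := by
    rw [← LinearMap.ker_eq_bot, LinearMap.ker_eq_bot']
    intro v hv
    have := LinearMap.toMatrix_mulVec_repr b' b φ v
    rw [hv, map_zero, Finsupp.coe_zero] at this
    have h0 := Matrix.eq_zero_of_mulVec_eq_zero hφ this
    exact b'.repr.map_eq_zero_iff.1 (DFunLike.coe_injective h0)
  let e : M' ≃ₗ[R] LinearMap.range φ := LinearEquiv.ofInjective φ hinj
  have hr : Module.finrank R (LinearMap.range φ) = Module.finrank R M := by
    rw [← e.finrank_eq, Module.finrank_eq_card_basis b', Module.finrank_eq_card_basis b]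
  refine ⟨Submodule.smithNormalFormCoeffs b hr, ?_,
    ⟨Submodule.quotientEquivPiSpan _ b hr⟩⟩
  set a := Submodule.smithNormalFormCoeffs b hr
  let tb := Submodule.smithNormalFormTopBasis b hr
  let ab := Submodule.smithNormalFormBotBasis b hr
  have hab := Submodule.smithNormalFormBotBasis_def b hr
  have h1 : LinearMap.toMatrix ab tb (LinearMap.range φ).subtype = Matrix.diagonal a := by
    ext i j
    rw [LinearMap.toMatrix_apply, Submodule.subtype_apply, hab, map_smul, Module.Basis.repr_self,
      Matrix.diagonal_apply]
    by_cases h : i = j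
    · subst h; simp [a]
    · simp [h]
  have h2 : LinearMap.toMatrix b' b φ = LinearMap.toMatrix tb b LinearMap.id *
      (LinearMap.toMatrix ab tb (LinearMap.range φ).subtype * LinearMap.toMatrix b' ab e) := by
    rw [← LinearMap.toMatrix_comp, ← LinearMap.toMatrix_comp]
    rfl
  have h3 : IsUnit (LinearMap.toMatrix tb b LinearMap.id).det :=
    LinearEquiv.isUnit_det (LinearEquiv.refl R M) tb b
  have h4 : IsUnit (LinearMap.toMatrix b' ab (e : M' →ₗ[R] LinearMap.range φ)).det :=
    LinearEquiv.isUnit_det e b' ab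
  rw [h2, h1, Matrix.det_mul, Matrix.det_mul, Matrix.det_diagonal]
  exact (associated_unit_mul_left _ _ h3).trans (associated_mul_unit_left _ _ h4)

/-! ### The local ring of a point of the line -/

section Line

variable {k : Type*} [Field k]

/-- The maximal ideal of the point `t` of the affine line. -/
def lineIdeal (t : k) : Ideal k[X] := Ideal.span {X - C t}

theorem mem_lineIdeal {t : k} {p : k[X]} : p ∈ lineIdeal t ↔ p.eval t = 0 := by
  rw [lineIdeal, Ideal.mem_span_singleton, dvd_iff_isRoot, IsRoot.def]

instance (t : k) : (lineIdeal t).IsPrime :=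
  (Ideal.span_singleton_prime (X_sub_C_ne_zero t)).2 (prime_X_sub_C t)

/-- The local ring of the affine line at `t`. -/
def LineLocal (t : k) : Type _ := Localization.AtPrime (lineIdeal t)

instance (t : k) : CommRing (LineLocal t) :=
  inferInstanceAs (CommRing (Localization.AtPrime (lineIdeal t)))

instance (t : k) : Algebra k[X] (LineLocal t) :=
  inferInstanceAs (Algebra k[X] (Localization.AtPrime (lineIdeal t)))

instance (t : k) : Algebra k (LineLocal t) :=
  inferInstanceAs (Algebra k (Localization.AtPrime (lineIdeal t)))

instance (t : k) : IsScalarTower k k[X] (LineLocal t) :=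
  inferInstanceAs (IsScalarTower k k[X] (Localization.AtPrime (lineIdeal t)))

instance (t : k) : IsLocalization.AtPrime (LineLocal t) (lineIdeal t) :=
  inferInstanceAs (IsLocalization.AtPrime (Localization.AtPrime (lineIdeal t)) (lineIdeal t))

instance (t : k) : IsDomain (LineLocal t) :=
  IsLocalization.isDomain_localization (lineIdeal t).primeCompl_le_nonZeroDivisors

instance (t : k) : IsPrincipalIdealRing (LineLocal t) :=
  inferInstanceAs (IsPrincipalIdealRing (Localization.AtPrime (lineIdeal t)))

theorem lineLocal_injective (t : k) : Function.Injective (algebraMap k[X] (LineLocal t)) :=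
  IsLocalization.injective _ (lineIdeal t).primeCompl_le_nonZeroDivisors

theorem lineLocal_isUnit {t : k} {p : k[X]} (hp : p.eval t ≠ 0) :
    IsUnit (algebraMap k[X] (LineLocal t) p) :=
  IsLocalization.map_units (LineLocal t)
    (⟨p, fun h => hp (mem_lineIdeal.1 h)⟩ : (lineIdeal t).primeCompl)

/-- Up to a unit of the local ring at `t`, a polynomial is the power of `X - t` given by the
multiplicity of the root `t`. -/
theorem lineLocal_associated (t : k) {p : k[X]} (hp : p ≠ 0) :
    Associated (algebraMap k[X] (LineLocal t) p)
      (algebraMap k[X] (LineLocal t) (X - C t) ^ p.rootMultiplicity t) := by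
  obtain ⟨q, hq, hq'⟩ := exists_eq_pow_rootMultiplicity_mul_and_not_dvd p hp t
  rw [dvd_iff_isRoot, IsRoot.def] at hq'
  conv_lhs => rw [hq]
  rw [map_mul, map_pow]
  exact associated_mul_unit_left _ _ (lineLocal_isUnit hq')

theorem lineLocal_prime (t : k) : Prime (algebraMap k[X] (LineLocal t) (X - C t)) := by
  have h0 : algebraMap k[X] (LineLocal t) (X - C t) ≠ 0 := by
    rw [Ne, map_eq_zero_iff _ (lineLocal_injective t)]
    exact X_sub_C_ne_zero t
  rw [← Ideal.span_singleton_prime h0]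
  have : IsLocalRing (LineLocal t) :=
    IsLocalization.AtPrime.isLocalRing (LineLocal t) (lineIdeal t)
  have h1 := IsLocalization.AtPrime.map_eq_maximalIdeal (lineIdeal t) (LineLocal t)
  have h : Ideal.span {algebraMap k[X] (LineLocal t) (X - C t)} =
      (lineIdeal t).map (algebraMap k[X] (LineLocal t)) := by
    refine Eq.trans ?_ (Ideal.map_span (algebraMap k[X] (LineLocal t)) {X - C t}).symm
    rw [Set.image_singleton]
  rw [h, h1]
  exact (IsLocalRing.maximalIdeal.isMaximal _).isPrime

/-- The ring `𝒪 / (x - t) ^ n` is `k[x] / (x - t) ^ n`, of dimension `n`. -/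
theorem finrank_quotient_pow (t : k) (n : ℕ) :
    Module.finrank k (LineLocal t ⧸
      Ideal.span {algebraMap k[X] (LineLocal t) (X - C t) ^ n}) = n := by
  have h : Ideal.span {algebraMap k[X] (LineLocal t) (X - C t) ^ n} =
      (Ideal.span {(X - C t) ^ n}).map (algebraMap k[X] (LineLocal t)) := by
    rw [Ideal.map_span, Set.image_singleton, map_pow]
  rw [h]
  change localMultiplicity k (lineIdeal t) _ = _
  have hc : ∀ s, s ∉ lineIdeal t → IsCoprime s ((X - C t) ^ n) := by
    intro s hs
    rw [mem_lineIdeal] at hs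
    refine (IsCoprime.symm ?_).pow_right
    exact (irreducible_X_sub_C t).coprime_iff_not_dvd.2 (by rwa [dvd_iff_isRoot])
  rw [localMultiplicity_eq_finrank (Q := k[X] ⧸ Ideal.span {(X - C t) ^ n}) _ _
    (Ideal.Quotient.mkₐ k _)]
  · have := finrank_quotient_span_eq_natDegree (f := (X - C t) ^ n)
    rw [this]; simp
  · intro s hs
    obtain ⟨u, v, huv⟩ := hc s hs
    refine IsUnit.of_mul_eq_one (Ideal.Quotient.mkₐ k _ u) ?_
    rw [← map_mul, ← map_one (Ideal.Quotient.mkₐ k _), Ideal.Quotient.mkₐ_eq_mk, Ideal.Quotient.eq,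
      Ideal.mem_span_singleton]
    exact ⟨-v, by linear_combination huv⟩
  · intro q
    obtain ⟨a, rfl⟩ := Ideal.Quotient.mk_surjective q
    exact ⟨a, 1, fun h => by simp [mem_lineIdeal] at h, by simp⟩
  · intro a
    rw [Ideal.Quotient.mkₐ_eq_mk, Ideal.Quotient.eq_zero_iff_mem]
    refine ⟨fun h => ⟨1, fun h => by simp [mem_lineIdeal] at h, by simpa using h⟩, ?_⟩
    rintro ⟨s, hs, h⟩
    rw [Ideal.mem_span_singleton] at h ⊢
    exact (hc s hs).symm.dvd_of_dvd_mul_left h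

theorem finite_quotient_pow (t : k) (n : ℕ) :
    Module.Finite k (LineLocal t ⧸
      Ideal.span {algebraMap k[X] (LineLocal t) (X - C t) ^ n}) := by
  rcases Nat.eq_zero_or_pos n with rfl | hn
  · have : Subsingleton (LineLocal t ⧸
      Ideal.span {algebraMap k[X] (LineLocal t) (X - C t) ^ 0}) := by
      rw [Ideal.Quotient.subsingleton_iff, pow_zero, Ideal.span_singleton_one]
    exact inferInstance
  · exact Module.finite_of_finrank_pos (by rw [finrank_quotient_pow]; exact hn)

/-- Over the local ring at `t`, the cokernel of a square matrix whose determinant is the nonzero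
polynomial `p` has as its dimension the multiplicity of the root `t` of `p`. -/
theorem finrank_cokernel {M M' ι : Type*} (t : k) [AddCommGroup M] [Module (LineLocal t) M]
    [Module k M] [IsScalarTower k (LineLocal t) M]
    [AddCommGroup M'] [Module (LineLocal t) M'] [Fintype ι] [DecidableEq ι]
    (b' : Module.Basis ι (LineLocal t) M') (b : Module.Basis ι (LineLocal t) M)
    (φ : M' →ₗ[LineLocal t] M) {p : k[X]} (hp : p ≠ 0)
    (hφ : (LinearMap.toMatrix b' b φ).det = algebraMap k[X] (LineLocal t) p) :
    Module.finrank k (M ⧸ LinearMap.range φ) = p.rootMultiplicity t := by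
  set ϖ := algebraMap k[X] (LineLocal t) (X - C t) with hϖ
  obtain ⟨a, ha, ⟨e⟩⟩ := exists_cokernel_equiv_pi b' b φ
    (by rw [hφ, Ne, map_eq_zero_iff _ (lineLocal_injective t)]; exact hp)
  rw [hφ] at ha
  have hass : Associated (∏ i, a i) (ϖ ^ p.rootMultiplicity t) :=
    ha.symm.trans (lineLocal_associated t hp)
  have hex : ∀ i, ∃ n, Associated (a i) (ϖ ^ n) := fun i => by
    obtain ⟨n, -, hn⟩ := (dvd_prime_pow (lineLocal_prime t) _).1
      ((Finset.dvd_prod_of_mem a (Finset.mem_univ i)).trans hass.dvd)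
    exact ⟨n, hn⟩
  choose n hn using hex
  have hsum : ∑ i, n i = p.rootMultiplicity t := by
    have h1 : Associated (ϖ ^ ∑ i, n i) (ϖ ^ p.rootMultiplicity t) := by
      rw [← Finset.prod_pow_eq_pow_sum]
      exact (Associated.prod _ _ _ fun i _ => (hn i).symm).trans hass
    have h2 : ∀ i j : ℕ, ϖ ^ i ∣ ϖ ^ j → i ≤ j := fun i j =>
      (pow_dvd_pow_iff (lineLocal_prime t).ne_zero (lineLocal_prime t).not_isUnit).1
    exact le_antisymm (h2 _ _ h1.dvd) (h2 _ _ h1.symm.dvd)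
  have hspan : ∀ i, Ideal.span {a i} = Ideal.span {ϖ ^ n i} := fun i =>
    Ideal.span_singleton_eq_span_singleton.2 (hn i)
  have : ∀ i, Module.Finite k (LineLocal t ⧸ Ideal.span {a i}) := fun i => by
    rw [hspan]; exact finite_quotient_pow t _
  rw [(e.restrictScalars k).finrank_eq, Module.finrank_pi_fintype, ← hsum]
  refine Finset.sum_congr rfl fun i _ => ?_
  rw [hspan, finrank_quotient_pow]

end Line

/-! ### The cokernel of the Sylvester map -/

section Sylvester

variable {R : Type*} [CommRing R]

theorem exists_eq_mul_add_of_isUnit_leadingCoeff {f : R[X]} (hf : IsUnit f.leadingCoeff)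
    (h : R[X]) :
    ∃ q r : R[X], h = f * q + r ∧ r ∈ degreeLT R f.natDegree := by
  nontriviality R
  obtain ⟨u, hu⟩ := hf
  have hm : (f * C (↑u⁻¹ : R)).Monic := by
    rw [mul_comm]
    exact monic_C_mul_of_mul_leadingCoeff_eq_one (by rw [← hu]; simp)
  have hd : (f * C (↑u⁻¹ : R)).degree = f.degree := by
    rw [mul_comm]
    exact degree_C_mul_of_mul_ne_zero (by rw [← hu]; simp)
  refine ⟨C (↑u⁻¹ : R) * (h /ₘ (f * C (↑u⁻¹ : R))), h %ₘ (f * C (↑u⁻¹ : R)), ?_, ?_⟩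
  · rw [← mul_assoc, add_comm, modByMonic_add_div]
  · rw [mem_degreeLT]
    refine (degree_modByMonic_lt _ hm).trans_le (hd.le.trans degree_le_natDegree)

/-- If the leading coefficient of `f` is a unit, then the cokernel of the Sylvester map of `f` and
`g` is the ring `R[X] / (f, g)`: division by `f` reduces every polynomial to a polynomial of
degree `< deg f + deg g`, and normalizes the Bézout coefficients of the elements of `(f, g)`. -/
theorem nonempty_cokernel_sylvesterMap_equiv (f g : R[X]) (hf : IsUnit f.leadingCoeff) :
    Nonempty ((degreeLT R (f.natDegree + g.natDegree) ⧸
      LinearMap.range (sylvesterMap f g le_rfl le_rfl)) ≃ₗ[R] R[X] ⧸ Ideal.span {f, g}) := by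
  nontriviality R
  let ρ : degreeLT R (f.natDegree + g.natDegree) →ₗ[R] R[X] ⧸ Ideal.span {f, g} :=
    (Ideal.Quotient.mkₐ R (Ideal.span {f, g})).toLinearMap ∘ₗ Submodule.subtype _
  have hρ : ∀ v, ρ v = Ideal.Quotient.mk (Ideal.span {f, g}) v := fun v => rfl
  have hsurj : LinearMap.range ρ = ⊤ := by
    rw [LinearMap.range_eq_top]
    intro z
    obtain ⟨h, rfl⟩ := Ideal.Quotient.mk_surjective z
    obtain ⟨q, r, hqr, hr⟩ := exists_eq_mul_add_of_isUnit_leadingCoeff hf h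
    refine ⟨⟨r, degreeLT_mono (Nat.le_add_right _ _) hr⟩, ?_⟩
    rw [hρ, Ideal.Quotient.eq, hqr, Ideal.mem_span_pair]
    exact ⟨-q, 0, by ring⟩
  have hker : LinearMap.range (sylvesterMap f g le_rfl le_rfl) = LinearMap.ker ρ := by
    ext ⟨v, hv⟩
    rw [LinearMap.mem_ker, hρ, Ideal.Quotient.eq_zero_iff_mem, LinearMap.mem_range]
    constructor
    · rintro ⟨⟨p, q⟩, hpq⟩
      rw [← hpq, sylvesterMap_apply_coe, Ideal.mem_span_pair]
      exact ⟨q, p, by ring⟩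
    · intro hmem
      obtain ⟨a, b, hab⟩ := Ideal.mem_span_pair.1 hmem
      obtain ⟨q, r, hqr, hr⟩ := exists_eq_mul_add_of_isUnit_leadingCoeff hf b
      have hv' : v = f * (a + g * q) + g * r := by
        rw [← show a * f + b * g = v from hab, hqr]; ring
      have hdeg : a + g * q ∈ degreeLT R g.natDegree := by
        have h1 : g * r ∈ degreeLT R (f.natDegree + g.natDegree) := by
          simpa using (sylvesterMap f g le_rfl le_rfl (⟨r, hr⟩, 0)).2
        have h2 : f * (a + g * q) ∈ degreeLT R (f.natDegree + g.natDegree) := by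
          have := Submodule.sub_mem _ hv h1
          rwa [hv', add_sub_cancel_right] at this
        rw [mem_degreeLT] at h2 ⊢
        by_cases h0 : a + g * q = 0
        · rw [h0, degree_zero]; exact WithBot.bot_lt_coe _
        have h3 : f.leadingCoeff * (a + g * q).leadingCoeff ≠ 0 := by
          rw [Ne, hf.mul_right_eq_zero, leadingCoeff_eq_zero]; exact h0
        have hf0 : f ≠ 0 := by
          rintro rfl; simp at h3
        rw [degree_mul' h3, degree_eq_natDegree hf0, degree_eq_natDegree h0] at h2
        rw [degree_eq_natDegree h0]
        norm_cast at h2 ⊢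
        omega
      refine ⟨(⟨r, hr⟩, ⟨a + g * q, hdeg⟩), ?_⟩
      ext1
      exact hv'.symm
  exact ⟨(Submodule.quotEquivOfEq _ _ hker).trans
    (ρ.quotKerEquivOfSurjective (LinearMap.range_eq_top.1 hsurj))⟩

end Sylvester

/-! ### The multiplicity of a root of a resultant as a dimension -/

/-- The image of a bivariate polynomial in `𝒪[y]`, where `𝒪` is the local ring of the line
at `t`. -/
abbrev toLineLocal {k : Type*} [Field k] (t : k) : k[X][Y] →+* (LineLocal t)[X] :=
  mapRingHom (algebraMap k[X] (LineLocal t))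

theorem finrank_quotient_span_pair_aux {k : Type*} [Field k] (t : k) (F G : k[X][Y])
    (hF : F.leadingCoeff.eval t ≠ 0) (hR : resultant F G ≠ 0) :
    Module.finrank k ((LineLocal t)[X] ⧸ Ideal.span {toLineLocal t F, toLineLocal t G}) =
      (resultant F G).rootMultiplicity t := by
  have hinj := lineLocal_injective t
  have hdF : (toLineLocal t F).natDegree = F.natDegree := natDegree_map_eq_of_injective hinj _
  have hdG : (toLineLocal t G).natDegree = G.natDegree := natDegree_map_eq_of_injective hinj _
  have hlc : IsUnit (toLineLocal t F).leadingCoeff := by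
    rw [coe_mapRingHom, leadingCoeff_map_of_injective hinj]
    exact lineLocal_isUnit hF
  obtain ⟨e⟩ := nonempty_cokernel_sylvesterMap_equiv (toLineLocal t F) (toLineLocal t G) hlc
  rw [← (e.restrictScalars k).finrank_eq]
  refine finrank_cokernel t
    (((degreeLT.basis (LineLocal t) _).prod (degreeLT.basis (LineLocal t) _)).reindex
      finSumFinEquiv) (degreeLT.basis (LineLocal t) _) _ hR ?_
  rw [toMatrix_sylvesterMap', ← resultant, hdF, hdG, coe_mapRingHom, resultant_map_map]

/-- If the leading coefficients of `F` and `G` do not both vanish at `t`, then the multiplicity of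
`t` as a root of `res_y(F, G)` is the dimension of `𝒪[y] / (F, G)`, where `𝒪` is the local ring of
the line at `t`. -/
theorem finrank_quotient_span_pair {k : Type*} [Field k] (t : k) (F G : k[X][Y])
    (hFG : F.leadingCoeff.eval t ≠ 0 ∨ G.leadingCoeff.eval t ≠ 0) (hR : resultant F G ≠ 0) :
    Module.finrank k ((LineLocal t)[X] ⧸ Ideal.span {toLineLocal t F, toLineLocal t G}) =
      (resultant F G).rootMultiplicity t := by
  rcases hFG with h | h
  · exact finrank_quotient_span_pair_aux t F G h hR
  · have hc : resultant F G = C ((-1) ^ (F.natDegree * G.natDegree)) * resultant G F := by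
      rw [resultant_comm]; simp
    have hc0 : ((-1) ^ (F.natDegree * G.natDegree) : k) ≠ 0 := by simp
    rw [hc] at hR ⊢
    have h2 := finrank_quotient_span_pair_aux t G F h (right_ne_zero_of_mul hR)
    rw [Set.pair_comm, h2, rootMultiplicity_mul hR, rootMultiplicity_C, zero_add]

/-! ### Multiplicity of an isolated point of a fibre -/

section Fibre

theorem mem_pointIdeal {p : ℂ × ℂ} {a : ℂ[X][Y]} : a ∈ pointIdeal p ↔ a.evalEval p.1 p.2 = 0 :=
  RingHom.mem_ker

theorem evalEval_eq_eval_map (a b : ℂ) (f : ℂ[X][Y]) :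
    f.evalEval a b = (f.map (evalRingHom a)).eval b := by
  rw [eval_map, ← coe_evalEvalRingHom, evalEvalRingHom_eq]; rfl

/-- A homomorphism to a domain that kills `x - t` and two polynomials whose restrictions to the
line `x = t` have at most the common zero `β` is evaluation at `(t, β)`. -/
theorem ringHom_eq_evalEval {κ : Type*} [CommRing κ] [IsDomain κ] (ψ : ℂ[X][Y] →+* κ)
    {t β : ℂ} {F G : ℂ[X][Y]} (hF : ψ F = 0) (hG : ψ G = 0) (ht : ψ (C (X - C t)) = 0)
    (hFG : F.leadingCoeff.eval t ≠ 0 ∨ G.leadingCoeff.eval t ≠ 0)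
    (huniq : ∀ β', F.evalEval t β' = 0 → G.evalEval t β' = 0 → β' = β) (b : ℂ[X][Y]) :
    ψ b = ψ (C (C (b.evalEval t β))) := by
  let ι : ℂ →+* κ := (ψ.comp C).comp C
  have hC : ψ.comp C = ι.comp (evalRingHom t) := by
    refine Polynomial.ringHom_ext (fun a => by simp [ι]) ?_
    rw [map_sub, map_sub, sub_eq_zero] at ht
    simpa [ι] using ht
  have hψ : ∀ h : ℂ[X][Y], ψ h = (h.map (evalRingHom t)).eval₂ ι (ψ Y) := by
    intro h
    rw [eval₂_map, ← hC]
    exact congrArg (fun φ : ℂ[X][Y] →+* κ => φ h)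
      (Polynomial.ringHom_ext (f := ψ) (g := eval₂RingHom (ψ.comp C) (ψ Y))
        (fun a => by simp) (by simp))
  -- the greatest common divisor of the restrictions is killed by `ψ` and splits into linear factors
  set D := EuclideanDomain.gcd (F.map (evalRingHom t)) (G.map (evalRingHom t)) with hD
  have hne : ∀ H : ℂ[X][Y], H.leadingCoeff.eval t ≠ 0 → H.map (evalRingHom t) ≠ 0 := by
    intro H hH h0
    apply hH
    have := congrArg (fun q => coeff q H.natDegree) h0
    simpa [coeff_map] using this
  have hD0 : D ≠ 0 := by
    rw [hD, Ne, EuclideanDomain.gcd_eq_zero_iff]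
    rintro ⟨h1, h2⟩
    exact hFG.elim (fun h => hne F h h1) (fun h => hne G h h2)
  have hDψ : D.eval₂ ι (ψ Y) = 0 := by
    rw [hD, EuclideanDomain.gcd_eq_gcd_ab, eval₂_add, eval₂_mul, eval₂_mul, ← hψ, ← hψ, hF, hG]
    simp
  have hroot : ∃ r ∈ D.roots, ψ Y = ι r := by
    rw [(IsAlgClosed.splits D).eq_prod_roots, eval₂_mul, eval₂_C, mul_eq_zero] at hDψ
    rcases hDψ with h | h
    · exact absurd ((map_eq_zero ι).1 h) (leadingCoeff_ne_zero.2 hD0)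
    · rw [← coe_eval₂RingHom, map_multiset_prod, Multiset.prod_eq_zero_iff, Multiset.map_map,
        Multiset.mem_map] at h
      obtain ⟨r, hr, h⟩ := h
      refine ⟨r, hr, sub_eq_zero.1 ?_⟩
      simpa using h
  obtain ⟨r, hr, hYr⟩ := hroot
  have hr0 : D.eval r = 0 := (mem_roots hD0).1 hr
  have hdvd : ∀ H, D ∣ H → H.eval r = 0 := fun H h => eval_eq_zero_of_dvd_of_eval_eq_zero h hr0
  have hrβ : r = β := huniq r
    ((evalEval_eq_eval_map t r F).trans (hdvd _ (EuclideanDomain.gcd_dvd_left _ _)))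
    ((evalEval_eq_eval_map t r G).trans (hdvd _ (EuclideanDomain.gcd_dvd_right _ _)))
  rw [hψ, hYr, eval₂_at_apply, ← evalEval_eq_eval_map, hrβ]
  rfl

/-- Let `σ` be an automorphism of the plane that carries the point `(t, β)` to `p`. If `(t, β)` is
the only common zero of `σ f` and `σ g` above `t`, then the multiplicity of `p` as a zero of
`{f, g}` is the multiplicity of `t` as a root of `res_y(σ f, σ g)`. Indeed `𝒪[y] / (σ f, σ g)` is
then a local ring, namely the quotient of the local ring of the plane by `(f, g)`. -/
theorem localMultiplicity_eq_rootMultiplicity (σ : ℂ[X][Y] ≃ₐ[ℂ] ℂ[X][Y]) (p : ℂ × ℂ) (t β : ℂ)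
    (hσ : ∀ h, (σ h).evalEval t β = h.evalEval p.1 p.2) (f g : ℂ[X][Y])
    (hlc : (σ f).leadingCoeff.eval t ≠ 0 ∨ (σ g).leadingCoeff.eval t ≠ 0)
    (hR : resultant (σ f) (σ g) ≠ 0)
    (hmem : C (resultant (σ f) (σ g)) ∈ Ideal.span {σ f, σ g})
    (huniq : ∀ β', (σ f).evalEval t β' = 0 → (σ g).evalEval t β' = 0 → β' = β) :
    localMultiplicity ℂ (pointIdeal p) (Ideal.span {f, g}) =
      (resultant (σ f) (σ g)).rootMultiplicity t := by
  rw [← finrank_quotient_span_pair t _ _ hlc hR]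
  set F := σ f with hF
  set G := σ g with hG
  set J : Ideal (LineLocal t)[X] := Ideal.span {toLineLocal t F, toLineLocal t G} with hJ
  let μ : ℂ[X][Y] →ₐ[ℂ] (LineLocal t)[X] := mapAlgHom (IsScalarTower.toAlgHom ℂ ℂ[X] (LineLocal t))
  have hμ : ∀ h, μ h = toLineLocal t h := fun h => rfl
  have hμinj : Function.Injective μ := map_injective _ (lineLocal_injective t)
  let π : ℂ[X][Y] →ₐ[ℂ] (LineLocal t)[X] ⧸ J := (Ideal.Quotient.mkₐ ℂ J).comp μ
  have hπ : ∀ h, π h = Ideal.Quotient.mk J (toLineLocal t h) := fun h => rfl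
  have hπspan : ∀ h ∈ Ideal.span {F, G}, π h = 0 := by
    intro h hh
    rw [hπ, Ideal.Quotient.eq_zero_iff_mem, hJ]
    have := Ideal.mem_map_of_mem (toLineLocal t) hh
    rwa [Ideal.map_span, Set.image_pair] at this
  have hline : ∀ m : ℂ[X], m.eval t ≠ 0 → IsUnit (π (C m)) := by
    intro m hm
    have h1 : toLineLocal t (C m) = C (algebraMap ℂ[X] (LineLocal t) m) := by
      rw [coe_mapRingHom, map_C]
    rw [hπ, h1]
    exact ((lineLocal_isUnit hm).map C).map (Ideal.Quotient.mk J)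
  -- a polynomial that does not vanish at `(t, β)` avoids every maximal ideal of the quotient
  have hunit : ∀ b : ℂ[X][Y], b.evalEval t β ≠ 0 → IsUnit (π b) := by
    intro b hb
    by_contra hnu
    obtain ⟨𝔪, h𝔪, hb𝔪⟩ := exists_max_ideal_of_mem_nonunits (mem_nonunits_iff.2 hnu)
    let ψ : ℂ[X][Y] →+* ((LineLocal t)[X] ⧸ J) ⧸ 𝔪 := (Ideal.Quotient.mk 𝔪).comp π.toRingHom
    have hψ : ∀ h, ψ h = Ideal.Quotient.mk 𝔪 (π h) := fun h => rfl
    have : IsDomain (((LineLocal t)[X] ⧸ J) ⧸ 𝔪) := Ideal.Quotient.isDomain 𝔪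
    have hψspan : ∀ h ∈ Ideal.span {F, G}, ψ h = 0 := fun h hh => by
      rw [hψ, hπspan h hh, map_zero]
    have hψline : ∀ m : ℂ[X], m.eval t ≠ 0 → ψ (C m) ≠ 0 := fun m hm =>
      ((hline m hm).map (Ideal.Quotient.mk 𝔪)).ne_zero
    -- the resultant lies in `(F, G)` and is a power of `x - t` up to a unit of `𝒪`
    have ht : ψ (C (X - C t)) = 0 := by
      obtain ⟨u, hu, hu'⟩ := exists_eq_pow_rootMultiplicity_mul_and_not_dvd _ hR t
      rw [dvd_iff_isRoot, IsRoot.def] at hu'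
      have h0 := hψspan _ hmem
      rw [hu, C_mul, C_pow, map_mul, map_pow] at h0
      exact eq_zero_of_pow_eq_zero ((mul_eq_zero.1 h0).resolve_right (hψline u hu'))
    have hψb := ringHom_eq_evalEval (κ := ((LineLocal t)[X] ⧸ J) ⧸ 𝔪) ψ
      (hψspan F (Ideal.subset_span (by simp))) (hψspan G (Ideal.subset_span (by simp)))
      ht hlc huniq b
    rw [hψ, Ideal.Quotient.eq_zero_iff_mem.2 hb𝔪] at hψb
    exact hψline (C (b.evalEval t β)) (by simpa using hb) hψb.symm
  -- every element of `𝒪[y]` is a fraction whose denominator is a polynomial in `x` alone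
  have hden : ∀ z : (LineLocal t)[X], ∃ (m : ℂ[X]) (a : ℂ[X][Y]), m.eval t ≠ 0 ∧
      z * μ (C m) = μ a := by
    intro z
    obtain ⟨m, hmP, hm⟩ := IsLocalization.integerNormalization_spec (lineIdeal t).primeCompl z
    refine ⟨m, IsLocalization.integerNormalization (lineIdeal t).primeCompl z,
      fun h => hmP (mem_lineIdeal.2 h), ?_⟩
    rw [hμ, hμ, coe_mapRingHom, hm, map_C, mul_comm, ← smul_eq_C_mul,
      algebraMap_smul]
  have hcons : ∀ m : ℂ[X], m.eval t ≠ 0 → σ.symm (C m) ∉ pointIdeal p := by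
    intro m hm h
    rw [mem_pointIdeal, ← hσ, AlgEquiv.apply_symm_apply, evalEval_C] at h
    exact hm h
  refine localMultiplicity_eq_finrank (k := ℂ) (A := ℂ[X][Y]) (Q := (LineLocal t)[X] ⧸ J) _ _
    (π.comp σ.toAlgHom) ?_ ?_ ?_
  · intro a ha
    rw [mem_pointIdeal, ← hσ] at ha
    exact hunit _ ha
  · intro q
    obtain ⟨z, rfl⟩ := Ideal.Quotient.mk_surjective q
    obtain ⟨m, a, hm, hz⟩ := hden z
    refine ⟨σ.symm a, σ.symm (C m), hcons m hm, ?_⟩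
    change Ideal.Quotient.mk J z * π (σ (σ.symm (C m))) = π (σ (σ.symm a))
    rw [AlgEquiv.apply_symm_apply, AlgEquiv.apply_symm_apply]
    exact congrArg (Ideal.Quotient.mk J) hz
  · intro a
    change π (σ a) = 0 ↔ _
    constructor
    · intro ha
      rw [hπ, Ideal.Quotient.eq_zero_iff_mem, hJ, Ideal.mem_span_pair] at ha
      obtain ⟨u, v, huv⟩ := ha
      obtain ⟨m, U, hm, hu⟩ := hden u
      obtain ⟨n, V, hn, hv⟩ := hden v
      refine ⟨σ.symm (C (m * n)), hcons _ (by rw [eval_mul]; exact mul_ne_zero hm hn), ?_⟩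
      have h1 : C (m * n) * σ a = (C n * U) * F + (C m * V) * G := by
        apply hμinj
        simp only [map_add, map_mul, ← hu, ← hv]
        rw [hμ (σ a), ← huv, hμ F, hμ G]
        ring
      rw [Ideal.mem_span_pair]
      refine ⟨σ.symm (C n * U), σ.symm (C m * V), ?_⟩
      apply σ.injective
      simp only [map_add, map_mul σ, AlgEquiv.apply_symm_apply]
      exact h1.symm
    · rintro ⟨s, hs, h⟩
      rw [mem_pointIdeal, ← hσ] at hs
      have h1 : σ (s * a) ∈ Ideal.span {F, G} := by
        obtain ⟨u, v, huv⟩ := Ideal.mem_span_pair.1 h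
        rw [← huv, map_add, map_mul, map_mul]
        exact Ideal.mem_span_pair.2 ⟨_, _, rfl⟩
      have h2 := hπspan _ h1
      rw [map_mul, map_mul] at h2
      exact ((hunit _ hs).mul_right_eq_zero).1 h2

end Fibre

/-! ### Zeros and resultants of bivariate systems -/

section Systems

/-- The extension of the coefficients to `ℂ`. -/
abbrev extendToComplex (K : Type*) [CommRing K] [Algebra K ℂ] : K[X][Y] →+* ℂ[X][Y] :=
  mapRingHom (mapRingHom (algebraMap K ℂ))

theorem aevalAeval_eq_evalEval_extend {K : Type*} [CommRing K] [Algebra K ℂ] (a b : ℂ)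
    (f : K[X][Y]) : aevalAeval a b f = (extendToComplex K f).evalEval a b := by
  have h : ((aevalAeval a b : K[X][Y] →ₐ[K] ℂ) : K[X][Y] →+* ℂ) =
      (evalEvalRingHom a b).comp (extendToComplex K) := by
    refine Polynomial.ringHom_ext' (Polynomial.ringHom_ext (fun r => ?_) ?_) ?_ <;> simp
  exact congrArg (fun φ : K[X][Y] →+* ℂ => φ f) h

theorem isZero_iff {K : Type*} [CommRing K] [Algebra K ℂ] {f g : K[X][Y]} {p : ℂ × ℂ} :
    IsZero f g p ↔ (extendToComplex K f).evalEval p.1 p.2 = 0 ∧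
      (extendToComplex K g).evalEval p.1 p.2 = 0 := by
  rw [IsZero, aevalAeval_eq_evalEval_extend, aevalAeval_eq_evalEval_extend]

/-- A common zero of a zero-dimensional system does not lie on a vertical line of common zeros, so
one of the two polynomials depends on `y`. -/
theorem natDegree_ne_zero_of_isZero {K : Type*} [CommRing K] [Algebra K ℂ] {f g : K[X][Y]}
    (hfg : IsZeroDimensional f g) {p : ℂ × ℂ} (hp : IsZero f g p) :
    f.natDegree ≠ 0 ∨ g.natDegree ≠ 0 := by
  by_contra! h
  obtain ⟨a, ha⟩ := natDegree_eq_zero.1 h.1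
  obtain ⟨b, hb⟩ := natDegree_eq_zero.1 h.2
  have hall : ∀ z : ℂ, IsZero f g (p.1, z) := by
    intro z
    rw [isZero_iff, ← ha, ← hb] at hp ⊢
    simpa only [coe_mapRingHom, map_C, evalEval_C] using hp
  refine Set.infinite_univ (α := ℂ) ((hfg.preimage (f := fun z : ℂ => (p.1, z)) ?_).subset
    fun z _ => hall z)
  intro z _ w _ hzw
  simpa using hzw

theorem C_resY_mem_span {K : Type*} [CommRing K] {f g : K[X][Y]}
    (h : f.natDegree ≠ 0 ∨ g.natDegree ≠ 0) : C (resY f g) ∈ Ideal.span {f, g} := by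
  obtain ⟨p, q, -, -, hpq⟩ := exists_mul_add_mul_eq_C_resultant f g le_rfl le_rfl h
  rw [resY, ← hpq, Ideal.mem_span_pair]
  exact ⟨p, q, by ring⟩

theorem aeval_resY_eq_zero {K : Type*} [CommRing K] [Algebra K ℂ] {f g : K[X][Y]}
    (hfg : IsZeroDimensional f g) {p : ℂ × ℂ} (hp : IsZero f g p) : aeval p.1 (resY f g) = 0 := by
  obtain ⟨u, v, huv⟩ := Ideal.mem_span_pair.1 (C_resY_mem_span (natDegree_ne_zero_of_isZero hfg hp))
  rw [← aevalAeval_C (R := K) p.1 p.2, ← huv, map_add, map_mul, map_mul, hp.1, hp.2]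
  simp

theorem resY_map {K : Type*} [Field K] [Algebra K ℂ] (f g : K[X][Y]) :
    resultant (extendToComplex K f) (extendToComplex K g) =
      (resY f g).map (algebraMap K ℂ) := by
  have hinj : Function.Injective (mapRingHom (algebraMap K ℂ)) :=
    map_injective _ (algebraMap K ℂ).injective
  rw [coe_mapRingHom, natDegree_map_eq_of_injective hinj, natDegree_map_eq_of_injective hinj,
    resultant_map_map]
  rfl

/-- Above a root of the resultant at which the leading coefficient of `f` does not vanish there is
a common zero of `f` and `g`. -/
theorem exists_isZero_of_aeval_resY {K : Type*} [Field K] [Algebra K ℂ] {f g : K[X][Y]} {α : ℂ}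
    (hf : aeval α f.leadingCoeff ≠ 0) (hα : aeval α (resY f g) = 0) :
    ∃ β, IsZero f g (α, β) := by
  let φ : K[X] →+* ℂ := (aeval α : K[X] →ₐ[K] ℂ)
  have hφ : ∀ h : K[X][Y], (extendToComplex K h).map (evalRingHom α) = h.map φ := by
    intro h
    rw [coe_mapRingHom, Polynomial.map_map]
    congr 1
    exact Polynomial.ringHom_ext (fun r => by simp [φ]) (by simp [φ])
  have hlc : φ f.leadingCoeff ≠ 0 := hf
  have hdf : (f.map φ).natDegree = f.natDegree := natDegree_map_of_leadingCoeff_ne_zero _ hlc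
  obtain ⟨j, hj⟩ := Nat.exists_eq_add_of_le (natDegree_map_le (f := φ) (p := g))
  have hres : resultant (f.map φ) (g.map φ) = 0 := by
    have h1 : resultant (f.map φ) (g.map φ) f.natDegree g.natDegree = 0 := by
      rw [resultant_map_map]; exact hα
    rw [hj, resultant_add_right_deg _ _ _ _ _ le_rfl, mul_eq_zero] at h1
    rw [hdf]
    refine h1.resolve_left (pow_ne_zero _ ?_)
    rwa [coeff_map]
  obtain ⟨β, h1, h2⟩ : ∃ β, (f.map φ).eval β = 0 ∧ (g.map φ).eval β = 0 := by
    by_contra! hcon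
    refine (resultant_eq_zero_iff.1 hres).2 (isCoprime_of_dvd _ _ ?_ ?_)
    · rintro ⟨h, -⟩
      rw [← leadingCoeff_eq_zero, leadingCoeff_map_of_leadingCoeff_ne_zero _ hlc] at h
      exact hlc h
    · intro z hz hz0 hzf hzg
      obtain ⟨β, hβ⟩ := IsAlgClosed.exists_root z
        (fun h => hz (isUnit_iff_degree_eq_zero.2 h))
      exact hcon β (eval_eq_zero_of_dvd_of_eval_eq_zero hzf hβ)
        (eval_eq_zero_of_dvd_of_eval_eq_zero hzg hβ)
  refine ⟨β, isZero_iff.2 ?_⟩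
  rw [evalEval_eq_eval_map, evalEval_eq_eval_map, hφ, hφ]
  exact ⟨h1, h2⟩

theorem resY_comm {K : Type*} [CommRing K] (f g : K[X][Y]) :
    resY f g = (-1) ^ (f.natDegree * g.natDegree) * resY g f :=
  resultant_comm _ _ _ _

end Systems

/-! ### The shear -/

section Shear

theorem aevalAeval_shear {K A : Type*} [CommRing K] [CommRing A] [Algebra K A] (s : K)
    (f : ℤ[X][Y]) (a b : A) :
    aevalAeval a b (shear s f) = aevalAeval (a + algebraMap K A s * b) b f := by
  have h : ((aevalAeval a b : K[X][Y] →ₐ[K] A) : K[X][Y] →+* A).comp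
      (aevalAeval (C X + C (C s) * Y : K[X][Y]) (Y : K[X][Y]) : ℤ[X][Y] →ₐ[ℤ] K[X][Y]) =
      ((aevalAeval (a + algebraMap K A s * b) b : ℤ[X][Y] →ₐ[ℤ] A) : ℤ[X][Y] →+* A) := by
    refine Polynomial.ringHom_ext' (Polynomial.ringHom_ext (fun r => ?_) ?_) ?_ <;> simp
  exact congrArg (fun φ : ℤ[X][Y] →+* A => φ f) h

theorem isZero_shear {K : Type*} [CommRing K] [Algebra K ℂ] (s : K) (f g : ℤ[X][Y]) (a b : ℂ) :
    IsZero (shear s f) (shear s g) (a, b) ↔ IsZero f g (a + algebraMap K ℂ s * b, b) := by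
  simp only [IsZero, aevalAeval_shear]

theorem isZeroDimensional_shear {K : Type*} [CommRing K] [Algebra K ℂ] (s : K) {f g : ℤ[X][Y]}
    (hfg : IsZeroDimensional f g) : IsZeroDimensional (shear s f) (shear s g) := by
  refine (hfg.preimage (f := fun p : ℂ × ℂ => (p.1 + algebraMap K ℂ s * p.2, p.2)) ?_).subset ?_
  · rintro ⟨a, b⟩ - ⟨a', b'⟩ - h
    simp only [Prod.mk.injEq] at h
    obtain ⟨h1, rfl⟩ := h
    simpa using h1
  · rintro ⟨a, b⟩ h
    exact (isZero_shear s f g a b).1 h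

/-- The automorphism `f(x, y) ↦ f(x + s y, y)` of the ring of bivariate polynomials. -/
def shearEquiv {K : Type*} [CommRing K] (s : K) : K[X][Y] ≃ₐ[K] K[X][Y] :=
  AlgEquiv.ofAlgHom (aevalAeval (C X + C (C s) * Y : K[X][Y]) (Y : K[X][Y]))
    (aevalAeval (C X - C (C s) * Y : K[X][Y]) (Y : K[X][Y])) (by ext <;> simp) (by ext <;> simp)

theorem shearEquiv_apply {K : Type*} [CommRing K] (s : K) (f : K[X][Y]) :
    shearEquiv s f = aevalAeval (C X + C (C s) * Y : K[X][Y]) (Y : K[X][Y]) f := rfl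

theorem evalEval_shearEquiv {K : Type*} [CommRing K] (s : K) (f : K[X][Y]) (a b : K) :
    (shearEquiv s f).evalEval a b = f.evalEval (a + s * b) b := by
  have h : (evalEvalRingHom a b).comp
      (aevalAeval (C X + C (C s) * Y : K[X][Y]) (Y : K[X][Y]) : K[X][Y] →ₐ[K] K[X][Y]) =
      evalEvalRingHom (a + s * b) b := by
    refine Polynomial.ringHom_ext' (Polynomial.ringHom_ext (fun r => ?_) ?_) ?_ <;> simp
  exact congrArg (fun φ : K[X][Y] →+* K => φ f) h

theorem extendToComplex_shear {K : Type*} [CommRing K] [Algebra K ℂ] (s : K) (f : ℤ[X][Y]) :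
    extendToComplex K (shear s f) = shearEquiv (algebraMap K ℂ s) (toComplex f) := by
  have h : (extendToComplex K).comp
      (aevalAeval (C X + C (C s) * Y : K[X][Y]) (Y : K[X][Y]) : ℤ[X][Y] →ₐ[ℤ] K[X][Y]) =
      ((shearEquiv (algebraMap K ℂ s) : ℂ[X][Y] →ₐ[ℂ] ℂ[X][Y]) : ℂ[X][Y] →+* ℂ[X][Y]).comp
        (extendToComplex ℤ) := by
    refine Polynomial.ringHom_ext' (Polynomial.ringHom_ext (fun r => ?_) ?_) ?_ <;>
      simp [shearEquiv_apply]
  exact congrArg (fun φ : ℤ[X][Y] →+* ℂ[X][Y] => φ f) h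

end Shear

/-! ### Systems in real generic position -/

section RealGeneric

variable {K : Type*} [Field K] [Algebra K ℂ]

/-- A zero-dimensional system in real generic position has a nonzero resultant, since otherwise it
has a zero above every real number. -/
theorem resY_ne_zero {f g : K[X][Y]} (hfg : IsZeroDimensional f g)
    (h : InRealGenericPosition f g) : resY f g ≠ 0 := by
  intro h0
  have hz : ∀ α : ℝ, ∃ β : ℂ, IsZero f g ((α : ℂ), β) := fun α =>
    (h.2 α (by rw [h0, map_zero])).exists
  choose β hβ using hz
  refine Set.infinite_univ (α := ℝ) ((hfg.preimage (f := fun α : ℝ => ((α : ℂ), β α)) ?_).subset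
    fun α _ => hβ α)
  intro a _ b _ hab
  simpa using (Prod.ext_iff.1 hab).1

theorem leadingCoeff_ne_zero_or {f g : K[X][Y]} (h : IsCoprime f.leadingCoeff g.leadingCoeff)
    (α : ℂ) : aeval α f.leadingCoeff ≠ 0 ∨ aeval α g.leadingCoeff ≠ 0 := by
  obtain ⟨u, v, huv⟩ := h
  by_contra! h0
  have := congrArg (aeval α) huv
  rw [map_add, map_mul, map_mul, h0.1, h0.2] at this
  simp at this

/-- A shear into real generic position turns the multiplicity of a real zero into the multiplicity
of the corresponding root of the resultant. -/
theorem rootMultiplicity_resY_shear {f g : ℤ[X][Y]} (hfg : IsZeroDimensional f g) (s : ℚ)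
    (hs : InRealGenericPosition (shear s f) (shear s g)) (p : ℝ × ℝ)
    (hp : IsZero f g ((p.1 : ℂ), (p.2 : ℂ))) :
    ((resY (shear s f) (shear s g)).map (algebraMap ℚ ℝ)).rootMultiplicity (p.1 - (s : ℝ) * p.2) =
      multiplicity f g ((p.1 : ℂ), (p.2 : ℂ)) := by
  set t : ℝ := p.1 - (s : ℝ) * p.2 with ht
  have hts : (t : ℂ) + algebraMap ℚ ℂ s * (p.2 : ℂ) = p.1 := by
    rw [ht]; simp
  have hzd := isZeroDimensional_shear s hfg
  have hz : IsZero (shear s f) (shear s g) ((t : ℂ), (p.2 : ℂ)) := by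
    rw [isZero_shear, hts]; exact hp
  have hlcmap : ∀ h : ℚ[X][Y], (extendToComplex ℚ h).leadingCoeff.eval (t : ℂ) =
      aeval (t : ℂ) h.leadingCoeff := by
    intro h
    rw [coe_mapRingHom, leadingCoeff_map_of_injective
      (map_injective _ (algebraMap ℚ ℂ).injective), coe_mapRingHom, eval_map_algebraMap]
  have hres := resY_map (shear s f) (shear s g)
  have hR0 : (resY (shear s f) (shear s g)).map (algebraMap ℚ ℂ) ≠ 0 := by
    rw [Ne, Polynomial.map_eq_zero]; exact resY_ne_zero hzd hs
  have hmem : C ((resY (shear s f) (shear s g)).map (algebraMap ℚ ℂ)) ∈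
      Ideal.span {extendToComplex ℚ (shear s f), extendToComplex ℚ (shear s g)} := by
    have := Ideal.mem_map_of_mem (extendToComplex ℚ)
      (C_resY_mem_span (natDegree_ne_zero_of_isZero hzd hz))
    rwa [Ideal.map_span, Set.image_pair, coe_mapRingHom, map_C] at this
  have huniq : ∀ β', (extendToComplex ℚ (shear s f)).evalEval (t : ℂ) β' = 0 →
      (extendToComplex ℚ (shear s g)).evalEval (t : ℂ) β' = 0 → β' = p.2 := fun β' h1 h2 =>
    (hs.2 t (aeval_resY_eq_zero hzd hz)).unique (isZero_iff.2 ⟨h1, h2⟩) hz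
  have hlc : (extendToComplex ℚ (shear s f)).leadingCoeff.eval (t : ℂ) ≠ 0 ∨
      (extendToComplex ℚ (shear s g)).leadingCoeff.eval (t : ℂ) ≠ 0 := by
    rw [hlcmap, hlcmap]; exact leadingCoeff_ne_zero_or hs.1 t
  rw [← hres] at hR0 hmem
  have hmap : ((resY (shear s f) (shear s g)).map (algebraMap ℚ ℝ)).rootMultiplicity t =
      ((resY (shear s f) (shear s g)).map (algebraMap ℚ ℂ)).rootMultiplicity (t : ℂ) := by
    rw [eq_rootMultiplicity_map (f := algebraMap ℝ ℂ) (algebraMap ℝ ℂ).injective,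
      Polynomial.map_map, ← IsScalarTower.algebraMap_eq]
    rfl
  rw [hmap, ← hres, BivariateShear.multiplicity]
  rw [extendToComplex_shear, extendToComplex_shear] at hR0 hmem hlc ⊢
  rw [extendToComplex_shear, extendToComplex_shear] at huniq
  exact (localMultiplicity_eq_rootMultiplicity (shearEquiv (algebraMap ℚ ℂ s))
    ((p.1 : ℂ), (p.2 : ℂ)) t p.2
    (fun h => by rw [evalEval_shearEquiv, hts]) _ _ hlc hR0 hmem huniq).symm

end RealGeneric

/-! ### Finiteness of the set of shears out of generic position -/

section Generic

theorem natDegree_coeff_linear_pow {K : Type*} [Field K] (s : K) (i : ℕ) :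
    ((C X + C (C s) * Y : K[X][Y]) ^ i).natDegree ≤ i ∧
      ((C X + C (C s) * Y : K[X][Y]) ^ i).coeff i = C (s ^ i) := by
  have h1 : (C X + C (C s) * Y : K[X][Y]).natDegree ≤ 1 := by
    rw [add_comm]; exact natDegree_linear_le
  refine ⟨(natDegree_pow_le_of_le i h1).trans (by simp), ?_⟩
  have := coeff_pow_of_natDegree_le (m := i) h1
  rw [mul_one] at this
  rw [this]
  simp

theorem natDegree_coeff_aeval_linear {K : Type*} [Field K] (s : K) (h : ℤ[X]) {e : ℕ}
    (he : h.natDegree ≤ e) :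
    (aeval (C X + C (C s) * Y : K[X][Y]) h).natDegree ≤ e ∧
      (aeval (C X + C (C s) * Y : K[X][Y]) h).coeff e = C ((h.coeff e : K) * s ^ e) := by
  rw [aeval_eq_sum_range' (Nat.lt_succ_of_le he)]
  constructor
  · refine natDegree_sum_le_of_forall_le _ _ fun i hi => ?_
    exact (natDegree_smul_le _ _).trans ((natDegree_coeff_linear_pow s i).1.trans
      (Nat.lt_succ_iff.1 (Finset.mem_range.1 hi)))
  · rw [finsetSum_coeff, Finset.sum_range_succ, Finset.sum_eq_zero, zero_add, coeff_smul,
      (natDegree_coeff_linear_pow s e).2]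
    · simp
    · intro i hi
      rw [coeff_smul]
      refine smul_eq_zero_of_right _ (coeff_eq_zero_of_natDegree_lt ?_)
      exact (natDegree_coeff_linear_pow s i).1.trans_lt (Finset.mem_range.1 hi)

/-- For all but finitely many `s` the leading coefficient of `f(x + s y, y)` with respect to `y` is
a nonzero constant: the coefficient of `y ^ d`, where `d` is the total degree of `f`, is the value
at `(s, 1)` of the form of degree `d` of `f`. -/
theorem finite_setOf_not_isUnit_leadingCoeff_shear {K : Type*} [Field K] [CharZero K] {f : ℤ[X][Y]}
    (hf : f ≠ 0) : {s : K | ¬ IsUnit (shear s f).leadingCoeff}.Finite := by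
  set d := f.support.sup fun j => (f.coeff j).natDegree + j with hd
  have hle : ∀ j ∈ f.support, (f.coeff j).natDegree + j ≤ d := fun j hj =>
    Finset.le_sup (f := fun j => (f.coeff j).natDegree + j) hj
  let P : K[X] := ∑ j ∈ f.support, C ((f.coeff j).coeff (d - j) : K) * X ^ (d - j)
  have hP : P ≠ 0 := by
    obtain ⟨j₀, hj₀, hmax⟩ := Finset.exists_mem_eq_sup f.support (support_nonempty.2 hf)
      fun j => (f.coeff j).natDegree + j
    intro h0
    have h1 := congrArg (fun q => coeff q (d - j₀)) h0
    simp only [P, finsetSum_coeff, coeff_C_mul_X_pow, coeff_zero] at h1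
    rw [Finset.sum_eq_single_of_mem j₀ hj₀, if_pos rfl] at h1
    · have h2 : d - j₀ = (f.coeff j₀).natDegree := by omega
      rw [h2, Int.cast_eq_zero, coeff_natDegree, leadingCoeff_eq_zero] at h1
      exact mem_support_iff.1 hj₀ h1
    · intro j hj hne
      have := hle j hj
      have := hle j₀ hj₀
      rw [if_neg (by omega)]
  have hshear : ∀ s : K, (shear s f).natDegree ≤ d ∧ (shear s f).coeff d = C (P.eval s) := by
    intro s
    have hsum : shear s f =
        ∑ j ∈ f.support, aeval (C X + C (C s) * Y : K[X][Y]) (f.coeff j) * Y ^ j := by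
      conv_lhs => rw [shear, as_sum_support_C_mul_X_pow f]
      simp
    rw [hsum]
    have hterm : ∀ j ∈ f.support, (f.coeff j).natDegree ≤ d - j := fun j hj => by
      have := hle j hj
      omega
    constructor
    · refine natDegree_sum_le_of_forall_le _ _ fun j hj => ?_
      refine natDegree_mul_le.trans ?_
      rw [natDegree_X_pow]
      have := (natDegree_coeff_aeval_linear s (f.coeff j) (hterm j hj)).1
      have := hle j hj
      omega
    · rw [finsetSum_coeff, eval_finsetSum, map_sum]
      refine Finset.sum_congr rfl fun j hj => ?_
      have h1 : d = (d - j) + j := by have := hle j hj; omega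
      conv_lhs => rw [h1, coeff_mul_X_pow]
      rw [(natDegree_coeff_aeval_linear s (f.coeff j) (hterm j hj)).2]
      simp
  refine (finite_setOfPred_isRoot hP).subset fun s hs => ?_
  by_contra hroot
  apply hs
  have h1 : (shear s f).coeff d ≠ 0 := by
    rw [(hshear s).2, Ne, C_eq_zero]; exact hroot
  have h2 : (shear s f).natDegree = d := le_antisymm (hshear s).1 (le_natDegree_of_ne_zero h1)
  rw [leadingCoeff, h2, (hshear s).2, isUnit_C]
  exact IsUnit.mk0 _ hroot

/-- For all but finitely many `s` the map `(x, y) ↦ x - s y` is injective on a given finite set. -/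
theorem finite_setOf_collision {K : Type*} [Field K] [Algebra K ℂ] {Z : Set (ℂ × ℂ)}
    (hZ : Z.Finite) : {s : K | ∃ p ∈ Z, ∃ q ∈ Z, p ≠ q ∧
      p.1 - algebraMap K ℂ s * p.2 = q.1 - algebraMap K ℂ s * q.2}.Finite := by
  have h : {s : K | ∃ p ∈ Z, ∃ q ∈ Z, p ≠ q ∧
      p.1 - algebraMap K ℂ s * p.2 = q.1 - algebraMap K ℂ s * q.2} =
      ⋃ p ∈ Z, ⋃ q ∈ Z, {s : K | p ≠ q ∧
        p.1 - algebraMap K ℂ s * p.2 = q.1 - algebraMap K ℂ s * q.2} := by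
    ext s; simp only [Set.mem_ofPred_eq, Set.mem_iUnion, exists_prop]
  rw [h]
  refine hZ.biUnion fun p _ => hZ.biUnion fun q _ => Set.Subsingleton.finite ?_
  rintro s ⟨hpq, hs⟩ s' ⟨-, hs'⟩
  have h1 : (algebraMap K ℂ s - algebraMap K ℂ s') * (p.2 - q.2) = 0 := by
    linear_combination hs' - hs
  rcases mul_eq_zero.1 h1 with h2 | h2
  · exact (algebraMap K ℂ).injective (sub_eq_zero.1 h2)
  · have h3 := sub_eq_zero.1 h2
    rw [h3] at hs
    exact absurd (Prod.ext (sub_left_injective hs) h3) hpq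

theorem inGenericPosition_shear {K : Type*} [Field K] [Algebra K ℂ] {f g : ℤ[X][Y]} {s : K}
    (hlc : IsUnit (shear s f).leadingCoeff ∨ IsUnit (shear s g).leadingCoeff)
    (hinj : ∀ p q, IsZero f g p → IsZero f g q →
      p.1 - algebraMap K ℂ s * p.2 = q.1 - algebraMap K ℂ s * q.2 → p = q) :
    InGenericPosition (shear s f) (shear s g) := by
  have hex : ∀ α : ℂ, aeval α (resY (shear s f) (shear s g)) = 0 →
      ∃ β, IsZero (shear s f) (shear s g) (α, β) := by
    intro α hα
    rcases hlc with h | h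
    · exact exists_isZero_of_aeval_resY (h.map (aeval α)).ne_zero hα
    · rw [resY_comm, map_mul] at hα
      have hα' : aeval α (resY (shear s g) (shear s f)) = 0 := by
        refine (mul_eq_zero.1 hα).resolve_left ?_
        simp
      obtain ⟨β, hβ⟩ := exists_isZero_of_aeval_resY (h.map (aeval α)).ne_zero hα'
      exact ⟨β, hβ.2, hβ.1⟩
  refine ⟨?_, fun α hα => ?_⟩
  · rcases hlc with h | h
    · obtain ⟨v, hv⟩ := h.exists_left_inv
      exact ⟨v, 0, by rw [hv, zero_mul, add_zero]⟩
    · obtain ⟨v, hv⟩ := h.exists_left_inv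
      exact ⟨0, v, by rw [hv, zero_mul, zero_add]⟩
  · obtain ⟨β, hβ⟩ := hex α hα
    refine ⟨β, hβ, fun β' hβ' => ?_⟩
    have := hinj _ _ ((isZero_shear s f g α β').1 hβ') ((isZero_shear s f g α β).1 hβ) (by simp)
    exact (Prod.ext_iff.1 this).2

theorem finite_setOf_not_inGenericPosition (K : Type*) [Field K] [Algebra K ℂ] {f g : ℤ[X][Y]}
    (hfg : IsZeroDimensional f g) :
    {s : K | ¬ InGenericPosition (shear s f) (shear s g)}.Finite := by
  have : CharZero K := (algebraMap K ℂ).charZero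
  have hne : f ≠ 0 ∨ g ≠ 0 := by
    by_contra! h
    obtain ⟨rfl, rfl⟩ := h
    refine Set.infinite_univ (α := ℂ × ℂ) (hfg.subset fun p _ => ?_)
    simp [IsZero]
  have hlc : {s : K | ¬ (IsUnit (shear s f).leadingCoeff ∨
      IsUnit (shear s g).leadingCoeff)}.Finite := by
    rcases hne with h | h
    · exact (finite_setOf_not_isUnit_leadingCoeff_shear h).subset fun s hs h => hs (Or.inl h)
    · exact (finite_setOf_not_isUnit_leadingCoeff_shear h).subset fun s hs h => hs (Or.inr h)
  refine (hlc.union (finite_setOf_collision hfg)).subset fun s hs => ?_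
  by_contra hcon
  rw [Set.mem_union, not_or] at hcon
  refine hs (inGenericPosition_shear (not_not.1 hcon.1) fun p q hp hq hpq => ?_)
  by_contra hne
  exact hcon.2 ⟨p, hp, q, hq, hne, hpq⟩

end Generic

/-! ### Counting admissible shears -/

section Counting

theorem isClosed_nonGenericSet (𝓑 : Finset (RInt × RInt)) : IsClosed (nonGenericSet 𝓑) := by
  have h : nonGenericSet 𝓑 = ⋃ b ∈ 𝓑, ⋃ b' ∈ 𝓑, {s : ℝ | b ≠ b' ∧
      (shearedProjection s b ∩ shearedProjection s b').Nonempty} := by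
    ext s; simp only [nonGenericSet, Set.mem_ofPred_eq, Set.mem_iUnion, exists_prop]
  rw [h]
  refine isClosed_biUnion_finset fun b _ => isClosed_biUnion_finset fun b' _ => ?_
  by_cases hb : b = b'
  · simp [hb]
  -- the set is the projection of a closed set along a compact space
  let T : Set ((ℝ × ℝ) × ℝ × ℝ) :=
    (realSet b.1 ×ˢ realSet b.2) ×ˢ realSet b'.1 ×ˢ realSet b'.2
  have hT : IsCompact T :=
    (isCompact_Icc.prod isCompact_Icc).prod (isCompact_Icc.prod isCompact_Icc)
  have : CompactSpace T := isCompact_iff_compactSpace.1 hT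
  have hcl : IsClosed {z : T × ℝ | z.1.1.1.1 - z.2 * z.1.1.1.2 = z.1.1.2.1 - z.2 * z.1.1.2.2} :=
    isClosed_eq (by fun_prop) (by fun_prop)
  convert isClosedMap_snd_of_compactSpace _ hcl using 1
  ext s
  simp only [Set.mem_ofPred_eq, Set.mem_image]
  constructor
  · rintro ⟨-, t, ⟨x, hx, y, hy, h1⟩, ⟨x', hx', y', hy', h2⟩⟩
    exact ⟨(⟨((x, y), (x', y')), ⟨hx, hy⟩, hx', hy'⟩, s), h1.symm.trans h2, rfl⟩
  · rintro ⟨⟨⟨⟨⟨x, y⟩, ⟨x', y'⟩⟩, ⟨hx, hy⟩, hx', hy'⟩, s'⟩, h1, rfl⟩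
    exact ⟨hb, x - s' * y, ⟨x, hx, y, hy, rfl⟩, ⟨x', hx', y', hy', h1⟩⟩

theorem infinite_admissibleShears {𝓑 : Finset (RInt × RInt)} (h : (admissibleShears 𝓑).Nonempty) :
    (admissibleShears 𝓑).Infinite := by
  obtain ⟨s, hs⟩ := h
  refine infinite_of_mem_nhds s ?_
  have h1 : IsOpen (admissibleShears 𝓑) :=
    isOpen_ne.inter ((isClosed_nonGenericSet 𝓑).isOpen_compl.preimage Rat.continuous_coe_real)
  exact h1.mem_nhds hs

theorem finite_setOf_bitsize_le (N : ℕ) : {s : ℚ | bitsize s ≤ N}.Finite := by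
  refine (((Set.finite_Icc (-(2 ^ N : ℤ)) (2 ^ N)).prod (Set.finite_Iic (2 ^ N : ℕ))).image
    fun p : ℤ × ℕ => (p.1 : ℚ) / p.2).subset fun s hs => ?_
  obtain ⟨h1, h2⟩ := max_le_iff.1 (show bitsize s ≤ N from hs)
  rw [Nat.size_le] at h1 h2
  refine ⟨(s.num, s.den), ⟨?_, h2.le⟩, Rat.num_div_den s⟩
  have h3 : (s.num.natAbs : ℤ) < 2 ^ N := by exact_mod_cast h1
  constructor <;> dsimp only <;> omega

/-- A finite set of exceptions does not affect the proportion in an infinite set that is exhausted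
by the finite level sets of a height function `ht`. -/
theorem tendsto_proportion {α : Type*} {A : Set α} (hA : A.Infinite) (ht : α → ℕ)
    (hfin : ∀ N, {a | ht a ≤ N}.Finite) {p : α → Prop} (hp : {a | ¬ p a}.Finite) :
    Tendsto (fun N : ℕ => ({a | a ∈ A ∧ ht a ≤ N ∧ p a}.ncard : ℝ) /
      ({a | a ∈ A ∧ ht a ≤ N}.ncard : ℝ)) atTop (𝓝 1) := by
  have hfinA : ∀ N, {a | a ∈ A ∧ ht a ≤ N}.Finite := fun N => (hfin N).subset fun a ha => ha.2
  have hfinG : ∀ N, {a | a ∈ A ∧ ht a ≤ N ∧ p a}.Finite := fun N =>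
    (hfin N).subset fun a ha => ha.2.1
  have hcount : Tendsto (fun N : ℕ => ({a | a ∈ A ∧ ht a ≤ N}.ncard : ℝ)) atTop atTop := by
    refine tendsto_natCast_atTop_atTop.comp (tendsto_atTop.2 fun M => ?_)
    obtain ⟨F, hFA, hF⟩ := hA.exists_subset_card_eq M
    filter_upwards [eventually_ge_atTop (F.sup ht)] with N hN
    rw [← hF, ← Set.ncard_coe_finset]
    exact Set.ncard_le_ncard (fun a ha => ⟨hFA ha, (Finset.le_sup ha).trans hN⟩) (hfinA N)
  have hupper : ∀ N, ({a | a ∈ A ∧ ht a ≤ N ∧ p a}.ncard : ℝ) ≤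
      ({a | a ∈ A ∧ ht a ≤ N}.ncard : ℝ) := fun N => by
    have h : {a | a ∈ A ∧ ht a ≤ N ∧ p a} ⊆ {a | a ∈ A ∧ ht a ≤ N} := fun a ha => ⟨ha.1, ha.2.1⟩
    exact_mod_cast Set.ncard_le_ncard h (hfinA N)
  have hlower : ∀ N, ({a | a ∈ A ∧ ht a ≤ N}.ncard : ℝ) - ({a | ¬ p a}.ncard : ℝ) ≤
      ({a | a ∈ A ∧ ht a ≤ N ∧ p a}.ncard : ℝ) := fun N => by
    rw [sub_le_iff_le_add]
    have h1 := Set.ncard_le_ncard (s := {a | a ∈ A ∧ ht a ≤ N})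
      (t := {a | a ∈ A ∧ ht a ≤ N ∧ p a} ∪ {a | ¬ p a}) (fun a ha => by
        by_cases h : p a
        · exact Or.inl ⟨ha.1, ha.2, h⟩
        · exact Or.inr h) ((hfinG N).union hp)
    exact_mod_cast h1.trans (Set.ncard_union_le _ _)
  have hlim : Tendsto (fun N : ℕ => 1 - ({a | ¬ p a}.ncard : ℝ) /
      ({a | a ∈ A ∧ ht a ≤ N}.ncard : ℝ)) atTop (𝓝 1) := by
    have := (tendsto_const_nhds (x := (1 : ℝ))).sub (hcount.const_div_atTop ({a | ¬ p a}.ncard : ℝ))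
    rwa [sub_zero] at this
  refine tendsto_of_tendsto_of_tendsto_of_le_of_le' hlim tendsto_const_nhds ?_ ?_
  · filter_upwards [hcount.eventually_gt_atTop 0] with N hN
    rw [le_div_iff₀ hN, sub_mul, div_mul_cancel₀ _ hN.ne', one_mul]
    exact hlower N
  · filter_upwards [hcount.eventually_gt_atTop 0] with N hN
    rw [div_le_one hN]
    exact hupper N

end Counting

/-! ### Interval arithmetic -/

section Intervals

theorem mem_realSet_imul {A B : RInt} {a b : ℝ} (ha : a ∈ realSet A) (hb : b ∈ realSet B) :
    a * b ∈ realSet (imul A B) := by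
  obtain ⟨ha1, ha2⟩ := ha
  obtain ⟨hb1, hb2⟩ := hb
  simp only [realSet, imul, Set.mem_Icc, Rat.cast_min, Rat.cast_max, Rat.cast_mul]
  constructor
  · have h1 : min ((A.fst : ℝ) * b) (A.snd * b) ≤ a * b := by
      rcases le_total 0 b with h | h
      · exact (min_le_left _ _).trans (mul_le_mul_of_nonneg_right ha1 h)
      · exact (min_le_right _ _).trans (mul_le_mul_of_nonpos_right ha2 h)
    have h2 : ∀ c : ℝ, min (c * B.fst) (c * B.snd) ≤ c * b := fun c => by
      rcases le_total 0 c with h | h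
      · exact (min_le_left _ _).trans (mul_le_mul_of_nonneg_left hb1 h)
      · exact (min_le_right _ _).trans (mul_le_mul_of_nonpos_left hb2 h)
    exact (min_le_min (h2 _) (h2 _)).trans h1
  · have h1 : a * b ≤ max ((A.fst : ℝ) * b) (A.snd * b) := by
      rcases le_total 0 b with h | h
      · exact (mul_le_mul_of_nonneg_right ha2 h).trans (le_max_right _ _)
      · exact (mul_le_mul_of_nonpos_right ha1 h).trans (le_max_left _ _)
    have h2 : ∀ c : ℝ, c * b ≤ max (c * B.fst) (c * B.snd) := fun c => by
      rcases le_total 0 c with h | h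
      · exact (mul_le_mul_of_nonneg_left hb2 h).trans (le_max_right _ _)
      · exact (mul_le_mul_of_nonpos_left hb1 h).trans (le_max_left _ _)
    exact h1.trans (max_le_max (h2 _) (h2 _))

theorem mem_realSet_foldr {I : RInt} {x : ℝ} (hx : x ∈ realSet I) (n : ℕ) (c : ℕ → ℤ) :
    ∑ k ∈ Finset.range n, (c k : ℝ) * x ^ k ∈ realSet ((List.range n).foldr
      (fun k A => NonemptyInterval.pure (c k : ℚ) + imul I A) (NonemptyInterval.pure 0)) := by
  induction n generalizing c with
  | zero => simp [realSet]
  | succ n ih =>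
    rw [List.range_succ_eq_map, List.foldr_cons, List.foldr_map, Finset.sum_range_succ']
    have h1 : ∑ k ∈ Finset.range n, (c (k + 1) : ℝ) * x ^ (k + 1) =
        x * ∑ k ∈ Finset.range n, (c (k + 1) : ℝ) * x ^ k := by
      rw [Finset.mul_sum]
      exact Finset.sum_congr rfl fun k _ => by ring
    have h2 := mem_realSet_imul hx (ih fun k => c (k + 1))
    rw [h1, pow_zero, mul_one, add_comm (x * _)]
    have h3 : ∀ A : RInt, x * ∑ k ∈ Finset.range n, (c (k + 1) : ℝ) * x ^ k ∈ realSet A →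
        (c 0 : ℝ) + x * ∑ k ∈ Finset.range n, (c (k + 1) : ℝ) * x ^ k ∈
          realSet (NonemptyInterval.pure (c 0 : ℚ) + A) := by
      rintro A ⟨h3, h4⟩
      simpa [realSet] using And.intro h3 h4
    exact h3 _ h2

/-- Interval evaluation encloses the values of a polynomial. -/
theorem aeval_mem_hornerEval (h : ℤ[X]) {I : RInt} {x : ℝ} (hx : x ∈ realSet I) :
    aeval x h ∈ realSet (hornerEval h I) := by
  rw [aeval_eq_sum_range]
  simpa only [zsmul_eq_mul, hornerEval] using mem_realSet_foldr hx (h.natDegree + 1) h.coeff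

/-- At `y ≥ 0` the two bounding polynomials enclose `f(x, y)`, so they have opposite weak signs at a
zero of `f(x, y)`. -/
theorem mem_nonnegRootRegion {f : ℤ[X][Y]} {I : RInt} {m : ℕ} {x y : ℝ} (hx : x ∈ realSet I)
    (hm : ∀ i, m < i → aeval x (f.coeff i) = 0) (hy : 0 ≤ y) (hf : aevalAeval x y f = 0) :
    y ∈ nonnegRootRegion f I m := by
  have hsum : ∑ i ∈ Finset.range (m + 1), aeval x (f.coeff i) * y ^ i = 0 := by
    let φ : ℤ[X] →+* ℝ := (aeval x : ℤ[X] →ₐ[ℤ] ℝ)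
    have h1 : (f.map φ).eval y = aevalAeval x y f := by
      have h : (evalRingHom y).comp (mapRingHom φ) =
          ((aevalAeval x y : ℤ[X][Y] →ₐ[ℤ] ℝ) : ℤ[X][Y] →+* ℝ) := by
        refine Polynomial.ringHom_ext' (Polynomial.ringHom_ext (fun r => ?_) ?_) ?_ <;> simp [φ]
      exact congrArg (fun θ : ℤ[X][Y] →+* ℝ => θ f) h
    have h2 : (f.map φ).natDegree < m + 1 := by
      rw [Nat.lt_succ_iff, natDegree_le_iff_coeff_eq_zero]
      intro i hi
      rw [coeff_map]
      exact hm i hi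
    rw [← hf, ← h1, eval_eq_sum_range' h2]
    exact Finset.sum_congr rfl fun i _ => by rw [coeff_map]; rfl
  refine ⟨hy, mul_nonpos_of_nonpos_of_nonneg ?_ ?_⟩
  · rw [← hsum, lowerPoly, map_sum]
    refine Finset.sum_le_sum fun i _ => ?_
    have := (aeval_mem_hornerEval (f.coeff i) hx).1
    simpa using mul_le_mul_of_nonneg_right this (pow_nonneg hy i)
  · rw [← hsum, upperPoly, map_sum]
    refine Finset.sum_le_sum fun i _ => ?_
    have := (aeval_mem_hornerEval (f.coeff i) hx).2
    simpa using mul_le_mul_of_nonneg_right this (pow_nonneg hy i)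

theorem mem_rootRegion {f : ℤ[X][Y]} {I : RInt} {m : ℕ} {x y : ℝ} (hx : x ∈ realSet I)
    (hm : ∀ i, m < i → aeval x (f.coeff i) = 0) (hf : aevalAeval x y f = 0) :
    y ∈ rootRegion f I m := by
  rcases le_total 0 y with hy | hy
  · exact Or.inl (mem_nonnegRootRegion hx hm hy hf)
  · refine Or.inr (mem_nonnegRootRegion hx (fun i hi => ?_) (neg_nonneg.2 hy) ?_)
    · rw [show -(Y : ℤ[X][Y]) = C (-1) * Y by rw [C_neg, C_1]; ring, comp_C_mul_X_coeff, map_mul,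
        hm i hi, zero_mul]
    · have h : ((aevalAeval x (-y) : ℤ[X][Y] →ₐ[ℤ] ℝ) : ℤ[X][Y] →+* ℝ).comp
          (compRingHom (-(Y : ℤ[X][Y]))) =
          ((aevalAeval x y : ℤ[X][Y] →ₐ[ℤ] ℝ) : ℤ[X][Y] →+* ℝ) := by
        refine Polynomial.ringHom_ext' (Polynomial.ringHom_ext (fun r => ?_) ?_) ?_ <;> simp
      have h1 := congrArg (fun θ : ℤ[X][Y] →+* ℝ => θ f) h
      exact (show aevalAeval x (-y) (f.comp (-(Y : ℤ[X][Y]))) = aevalAeval x y f from h1).trans hf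

end Intervals

/-! ### Real root candidates -/

section Candidates

theorem aevalAeval_ofReal (x y : ℝ) (f : ℤ[X][Y]) :
    aevalAeval (x : ℂ) (y : ℂ) f = ((aevalAeval x y f : ℝ) : ℂ) := by
  have h : ((aevalAeval (x : ℂ) (y : ℂ) : ℤ[X][Y] →ₐ[ℤ] ℂ) : ℤ[X][Y] →+* ℂ) =
      Complex.ofRealHom.comp ((aevalAeval x y : ℤ[X][Y] →ₐ[ℤ] ℝ) : ℤ[X][Y] →+* ℝ) := by
    refine Polynomial.ringHom_ext' (Polynomial.ringHom_ext (fun r => ?_) ?_) ?_ <;> simp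
  exact congrArg (fun θ : ℤ[X][Y] →+* ℂ => θ f) h

theorem isZero_ofReal {f g : ℤ[X][Y]} {p : ℝ × ℝ} :
    IsZero f g ((p.1 : ℂ), (p.2 : ℂ)) ↔ IsRealZero f g p := by
  simp only [IsZero, IsRealZero, aevalAeval_ofReal, Complex.ofReal_eq_zero]

theorem aevalAeval_conj (a b : ℂ) (f : ℤ[X][Y]) :
    aevalAeval (starRingEnd ℂ a) (starRingEnd ℂ b) f = starRingEnd ℂ (aevalAeval a b f) := by
  have h : ((aevalAeval (starRingEnd ℂ a) (starRingEnd ℂ b) : ℤ[X][Y] →ₐ[ℤ] ℂ) :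
      ℤ[X][Y] →+* ℂ) =
      (starRingEnd ℂ).comp ((aevalAeval a b : ℤ[X][Y] →ₐ[ℤ] ℂ) : ℤ[X][Y] →+* ℂ) := by
    refine Polynomial.ringHom_ext' (Polynomial.ringHom_ext (fun r => ?_) ?_) ?_ <;> simp
  exact congrArg (fun θ : ℤ[X][Y] →+* ℂ => θ f) h

theorem IsZero.conj {f g : ℤ[X][Y]} {a b : ℂ} (h : IsZero f g (a, b)) :
    IsZero f g (starRingEnd ℂ a, starRingEnd ℂ b) := by
  simp only [IsZero, aevalAeval_conj, map_eq_zero] at h ⊢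
  exact h

theorem aeval_ofReal_eq_zero {K : Type*} [CommRing K] [Algebra K ℝ] [Algebra K ℂ]
    [IsScalarTower K ℝ ℂ] (t : ℝ) (R : K[X]) : aeval (t : ℂ) R = 0 ↔ aeval t R = 0 := by
  rw [← Complex.coe_algebraMap, aeval_algebraMap_apply, Complex.coe_algebraMap,
    Complex.ofReal_eq_zero]

/-- Every real zero of the system lies in one of the real root candidates. -/
theorem exists_mem_candidates {f g : ℤ[X][Y]} (hfg : IsZeroDimensional f g)
    {𝓑 : Finset (RInt × RInt)} (h𝓑 : IsRealRootCandidates f g 𝓑) {p : ℝ × ℝ}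
    (hp : IsRealZero f g p) : ∃ b ∈ 𝓑, p.1 ∈ realSet b.1 ∧ p.2 ∈ realSet b.2 := by
  obtain ⟨𝓘, E, F, ⟨-, hcover, -⟩, hEF, hmem⟩ := h𝓑
  have hα : aeval p.1 (resY f g) = 0 :=
    (aeval_ofReal_eq_zero p.1 _).1 (aeval_resY_eq_zero hfg (isZero_ofReal.2 hp))
  obtain ⟨J, hJ, hpJ⟩ := hcover p.1 hα
  obtain ⟨B, hB, hroots⟩ := hEF J hJ
  obtain ⟨⟨m, hm, hE⟩, ⟨n, hn, hF⟩⟩ := hroots p.1 hpJ hα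
  have hpB := hB p hpJ hp
  obtain ⟨A, hA, hpA⟩ := Set.mem_iUnion₂.1 (hE ⟨mem_rootRegion hpJ hm hp.1, hpB⟩)
  obtain ⟨A', hA', hpA'⟩ := Set.mem_iUnion₂.1 (hF ⟨mem_rootRegion hpJ hn hp.2, hpB⟩)
  have hle : max A.fst A'.fst ≤ min A.snd A'.snd := by
    have h : ((max A.fst A'.fst : ℚ) : ℝ) ≤ ((min A.snd A'.snd : ℚ) : ℝ) := by
      rw [Rat.cast_max, Rat.cast_min]
      exact (max_le hpA.1 hpA'.1).trans (le_min hpA.2 hpA'.2)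
    exact_mod_cast h
  let K : RInt := ⟨⟨max A.fst A'.fst, min A.snd A'.snd⟩, hle⟩
  have hK : realSet K = realSet A ∩ realSet A' := by
    simp only [realSet, K, Set.Icc_inter_Icc, Rat.cast_max, Rat.cast_min]
  exact ⟨(J, K), (hmem J K).2 ⟨hJ, A, hA, A', hA', hK⟩, hpJ, by rw [hK]; exact ⟨hpA, hpA'⟩⟩

/-- For an admissible shear into real generic position, the sheared projection is a bijection from
the real zeros in a box onto the real roots of the resultant in the projection of the box. -/
theorem bijOn_shearedProjection {f g : ℤ[X][Y]} (hfg : IsZeroDimensional f g)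
    {𝓑 : Finset (RInt × RInt)} (h𝓑 : IsRealRootCandidates f g 𝓑) {s : ℚ}
    (hs : s ∈ admissibleShears 𝓑) (hgen : InRealGenericPosition (shear s f) (shear s g))
    {J K : RInt} (hJK : (J, K) ∈ 𝓑) :
    Set.BijOn (fun p : ℝ × ℝ => p.1 - (s : ℝ) * p.2)
      {p : ℝ × ℝ | p.1 ∈ realSet J ∧ p.2 ∈ realSet K ∧ IsRealZero f g p}
      {t : ℝ | t ∈ shearedProjection s (J, K) ∧
        aeval t (resY (shear s f) (shear s g)) = 0} := by
  have hzd := isZeroDimensional_shear s hfg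
  have hshear : ∀ (t : ℝ) (β : ℂ), IsZero (shear s f) (shear s g) ((t : ℂ), β) ↔
      IsZero f g ((t : ℂ) + (s : ℂ) * β, β) := fun t β => by
    rw [isZero_shear]; simp
  have hzero : ∀ p : ℝ × ℝ, IsRealZero f g p →
      IsZero (shear s f) (shear s g) (((p.1 - (s : ℝ) * p.2 : ℝ) : ℂ), (p.2 : ℂ)) := by
    intro p hp
    rw [hshear]
    convert isZero_ofReal.2 hp using 2
    push_cast; ring
  have hres : ∀ p : ℝ × ℝ, IsRealZero f g p →
      aeval ((p.1 - (s : ℝ) * p.2 : ℝ) : ℂ) (resY (shear s f) (shear s g)) = 0 := fun p hp =>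
    aeval_resY_eq_zero hzd (hzero p hp)
  refine ⟨?_, ?_, ?_⟩
  · rintro p ⟨h1, h2, hp⟩
    exact ⟨⟨p.1, h1, p.2, h2, rfl⟩, (aeval_ofReal_eq_zero _ _).1 (hres p hp)⟩
  · rintro p ⟨-, -, hp⟩ q ⟨-, -, hq⟩ hpq
    have hpq : p.1 - (s : ℝ) * p.2 = q.1 - (s : ℝ) * q.2 := hpq
    have hq' := hzero q hq
    rw [← hpq] at hq'
    have h2 : p.2 = q.2 :=
      Complex.ofReal_injective ((hgen.2 _ (hres p hp)).unique (hzero p hp) hq')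
    rw [h2] at hpq
    exact Prod.ext (sub_left_injective hpq) h2
  · rintro t ⟨ht, hroot⟩
    obtain ⟨β, hβ, huniq⟩ := hgen.2 t ((aeval_ofReal_eq_zero _ _).2 hroot)
    -- the unique zero above the real number `t` is invariant under complex conjugation
    have hconj : starRingEnd ℂ β = β := by
      refine huniq _ ((hshear t _).2 ?_)
      have := IsZero.conj ((hshear t β).1 hβ)
      simpa using this
    obtain ⟨y, rfl⟩ := Complex.conj_eq_iff_real.1 hconj
    have hp : IsRealZero f g (t + (s : ℝ) * y, y) := by
      rw [← isZero_ofReal]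
      have := (hshear t y).1 hβ
      simpa using this
    obtain ⟨b, hb, hb1, hb2⟩ := exists_mem_candidates hfg h𝓑 hp
    have htb : t ∈ shearedProjection s b := ⟨_, hb1, _, hb2, by ring⟩
    have hbJK : b = (J, K) := by
      by_contra hne
      exact hs.2 ⟨b, hb, (J, K), hJK, hne, t, htb, ht⟩
    subst hbJK
    exact ⟨(t + (s : ℝ) * y, y), ⟨hb1, hb2, hp⟩, by simp⟩

end Candidates

end BivariateShear

end

open BivariateShear in
theorem mainTheorem2 (f g : ℤ[X][Y]) (hfg : IsZeroDimensional f g)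
    (𝓑 : Finset (RInt × RInt)) (h𝓑 : IsRealRootCandidates f g 𝓑) :
    -- a random shear leads to a generic position with probability 1:
    -- there are only finitely many exceptional real `s`
    {s : ℝ | ¬ InGenericPosition (shear s f) (shear s g)}.Finite ∧
    -- so the exceptional set is null for every atomless law of `s`
    (∀ μ : Measure ℝ, IsProbabilityMeasure μ → NullSingletonClass μ →
      ∀ᵐ s ∂μ, InGenericPosition (shear s f) (shear s g)) ∧
    -- and, as soon as `ℚ \ S` has a nonzero element, the proportion of the good elements among the
    -- admissible rationals of bitsize at most `N` tends to 1
    ((admissibleShears 𝓑).Nonempty →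
      Tendsto (fun N : ℕ =>
        ({s : ℚ | s ∈ admissibleShears 𝓑 ∧ bitsize s ≤ N ∧
            InGenericPosition (shear s f) (shear s g)}.ncard : ℝ) /
          ({s : ℚ | s ∈ admissibleShears 𝓑 ∧ bitsize s ≤ N}.ncard : ℝ)) atTop (𝓝 1)) ∧
    -- for every admissible `s` (in particular one of minimal bitsize) with sheared system in
    -- generic position, `(x, y) ↦ x - s y` is a multiplicity-preserving bijection for each box
    (∀ s ∈ admissibleShears 𝓑, InRealGenericPosition (shear s f) (shear s g) →
      ∀ J K : RInt, (J, K) ∈ 𝓑 →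
        Set.BijOn (fun p : ℝ × ℝ => p.1 - (s : ℝ) * p.2)
          {p : ℝ × ℝ | p.1 ∈ realSet J ∧ p.2 ∈ realSet K ∧ IsRealZero f g p}
          {t : ℝ | t ∈ shearedProjection s (J, K) ∧
            aeval t (resY (shear s f) (shear s g)) = 0} ∧
        ∀ p : ℝ × ℝ, p.1 ∈ realSet J → p.2 ∈ realSet K → IsRealZero f g p →
          ((resY (shear s f) (shear s g)).map (algebraMap ℚ ℝ)).rootMultiplicity
              (p.1 - (s : ℝ) * p.2) =
            multiplicity f g ((p.1 : ℂ), (p.2 : ℂ))) := by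
  refine ⟨finite_setOf_not_inGenericPosition ℝ hfg, fun μ _ _ => ?_, fun hne => ?_,
    fun s hs hgen J K hJK => ⟨bijOn_shearedProjection hfg h𝓑 hs hgen hJK, fun p _ _ hp => ?_⟩⟩
  · exact (finite_setOf_not_inGenericPosition ℝ hfg).measure_zero μ
  · exact tendsto_proportion (infinite_admissibleShears hne) bitsize finite_setOf_bitsize_le
      (finite_setOf_not_inGenericPosition ℚ hfg)
  · exact rootMultiplicity_resY_shear hfg s hgen p (isZero_ofReal.2 hp)
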